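/- Let $\rho,\sigma$ be density matrices (positive semidefinite, trace one) on a finite-dimensional complex Hilbert space with $\operatorname{supp}\rho\subseteq\operatorname{supp}\sigma$ (for instance $\sigma$ of full rank). Let $D=\operatorname{Tr}\rho(\log\rho-\log\sigma)$ be the relative entropy (logarithms are natural and taken on the supports) and $V=\operatorname{Tr}\rho(\log\rho-\log\sigma)^2-D^2$ the relative variance, and assume $V>0$. Write $\rho=\sum_x\lambda(x)|a_x\rangle\langle a_x|$ and $\sigma=\sum_y\mu(y)|b_y\rangle\langle b_y|$ in orthonormal eigenbases, let $(X,Y)$ have the joint distribution $P(x,y)=\lambda(x)\,|\langle b_y|a_x\rangle|^2$, and put $T^3=\mathbb E\bigl|\log\frac{\lambda(X)}{\mu(Y)}-D\bigr|^3$. For $0\le\varepsilon\le1$ and $n\ge 1$ let $$\beta_n(\varepsilon)=\min\bigl\{\operatorname{Tr}(\sigma^{\otimes n}A)\;:\;0\le A\le 1,\ \operatorname{Tr}(\rho^{\otimes n}(1-A))\le\varepsilon\bigr\}$$ be the minimal type-II error subject to a type-I error of at most $\varepsilon$ (with $-\log 0=+\infty$). Let $\Phi$ be the standard normal distribution function,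 with $\Phi^{-1}(0)=-\infty$ and $\Phi^{-1}(1)=+\infty$. Let $C$ be the Berry–Esseen constant, i.e. the smallest constant such that for all i.i.d. real random variables $X_1,\dots,X_n$, $n\ge1$, with mean $m$, variance $\varrho^2>0$ and $\mathbb E|X_i-m|^3=\varsigma^3<\infty$, and all $x\in\mathbb R$, $$\Bigl|\Pr\Bigl\{\sqrt n\Bigl(\tfrac1n\sum_{i=1}^nX_i-m\Bigr)\le x\Bigr\}-\Phi(x/\varrho)\Bigr|\le\frac{C\varsigma^3}{\sqrt n\,\varrho^3}.$$ 1. For every $n\ge1$ with $\varepsilon-\frac{1}{\sqrt n}\frac{CT^3}{\sqrt V^3}\ge0$, $$-\log\beta_n(\varepsilon)\ \ge\ nD+\sqrt n\sqrt V\,\Phi^{-1}\Bigl(\varepsilon-\frac{1}{\sqrt n}\frac{CT^3}{\sqrt V^3}\Bigr),$$ and, if $0<\varepsilon<1$, the right-hand side equals $nD+\sqrt n\sqrt V\,\Phi^{-1}(\varepsilon)+O(1)$ as $n\to\infty$. 2. For every $n\ge1$ with $\varepsilon+\frac{1}{\sqrt n}\bigl(\frac{CT^3}{\sqrt V^3}+2\bigr)\le1$,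 $$-\log\beta_n(\varepsilon)\ \le\ nD+\sqrt n\sqrt V\,\Phi^{-1}\Bigl(\varepsilon+\frac{1}{\sqrt n}\Bigl(\frac{CT^3}{\sqrt V^3}+2\Bigr)\Bigr)+\log(2^9n^2),$$ and, if $0<\varepsilon<1$, the right-hand side equals $nD+\sqrt n\sqrt V\,\Phi^{-1}(\varepsilon)+2\log n+O(1)$ as $n\to\infty$. 3. Consequently, if $0<\varepsilon<1$, then $-\log\beta_n(\varepsilon)=nD+\sqrt{nV}\,\Phi^{-1}(\varepsilon)+r_n$ for all $n\ge1$, where $r_n=O(\log n)$ and, for some constant $K$ and all sufficiently large $n$, $-K\le r_n\le 2\log n+K$. The constants implied by $O(\cdot)$, and $K$, may depend on $\rho,\sigma,\varepsilon$. -/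

import Mathlib

open MeasureTheory ProbabilityTheory Filter Asymptotics

noncomputable section

namespace QHT

open scoped ComplexOrder

/-! ### The standard normal distribution and its quantile function -/

/-- The cumulative distribution function `Φ` of the standard normal distribution. -/
def normalCDF (x : ℝ) : ℝ := cdf (gaussianReal 0 1) x

/-- The inverse `Φ⁻¹` of `Φ`, on the closed interval `[0, 1]`, with the usual limiting values
`Φ⁻¹(0) = -∞` and `Φ⁻¹(1) = +∞`. -/
def normalQuantile (p : ℝ) : EReal :=
  sSup ((fun x : ℝ => (x : EReal)) '' {x : ℝ | normalCDF x ≤ p})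

/-- `-log x` for `x ≥ 0`, with `-log 0 = +∞`. -/
def negLog (x : ℝ) : EReal := -ENNReal.log (ENNReal.ofReal x)

/-! ### The Berry–Esseen constant -/

/-- `C` is an admissible constant in the Berry–Esseen inequality: for every law `P` on `ℝ` with a
finite third absolute moment and a positive variance, every sample size `n ≥ 1`, and `n` i.i.d.
variables with law `P` (the coordinates of the `n`-fold product of `P`). -/
def IsBerryEsseenBound (C : ℝ) : Prop :=
  ∀ (P : Measure ℝ) [IsProbabilityMeasure P],
    Integrable (fun t => |t| ^ 3) P → 0 < Var[id; P] →
    ∀ n : ℕ, 1 ≤ n → ∀ x : ℝ,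
      |(Measure.pi (fun _ : Fin n => P)).real
          {ω | √n * ((1 / (n : ℝ)) * ∑ i, ω i - ∫ t, t ∂P) ≤ x}
        - normalCDF (x / √(Var[id; P]))|
      ≤ C * (∫ t, |t - ∫ s, s ∂P| ^ 3 ∂P) / (√n * √(Var[id; P]) ^ 3)

/-- The Berry–Esseen constant: the best constant in the Berry–Esseen inequality. -/
def berryEsseenConstant : ℝ := sInf {C : ℝ | IsBerryEsseenBound C}

/-! ### States and entropic quantities -/

variable {ι : Type*} [Fintype ι]

/-- Density matrices: positive semidefinite with trace one. -/
def IsDensityMatrix (ρ : Matrix ι ι ℂ) : Prop := ρ.PosSemidef ∧ ρ.trace = 1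

theorem IsDensityMatrix.isHermitian {ρ : Matrix ι ι ℂ} (h : IsDensityMatrix ρ) : ρ.IsHermitian :=
  h.1.isHermitian

variable [DecidableEq ι]

/-- The support of a Hermitian matrix, i.e. its range (the orthogonal complement of its kernel). -/
def supp (X : Matrix ι ι ℂ) : Submodule ℂ (ι → ℂ) := LinearMap.range X.mulVecLin

/-- The logarithm of a positive semidefinite matrix, by functional calculus, taken on the support
(`log 0 = 0` on the kernel). -/
def matLog (X : Matrix ι ι ℂ) : Matrix ι ι ℂ := cfc Real.log X

/-- The quantum relative entropy `D(ρ‖σ)`, for `supp ρ ⊆ supp σ`. -/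
def relEntropy (ρ σ : Matrix ι ι ℂ) : ℝ :=
  (ρ * (matLog ρ - matLog σ)).trace.re

/-- The quantum relative variance `V(ρ‖σ)`, for `supp ρ ⊆ supp σ`. -/
def relVariance (ρ σ : Matrix ι ι ℂ) : ℝ :=
  (ρ * (matLog ρ - matLog σ) ^ 2).trace.re - relEntropy ρ σ ^ 2

/-- The joint distribution `P(x, y) = λ(x) |⟨b_y | a_x⟩|²`, where `λ(x)`, `a_x` are the eigenvalues
and orthonormal eigenvectors of `ρ`, and `b_y` those of `σ`. -/
def jointProb {ρ σ : Matrix ι ι ℂ} (hρ : ρ.IsHermitian) (hσ : σ.IsHermitian) (x y : ι) : ℝ :=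
  hρ.eigenvalues x * ‖inner ℂ (hσ.eigenvectorBasis y) (hρ.eigenvectorBasis x)‖ ^ 2

/-- The third absolute central moment `T³ = 𝔼 |log (λ(X) / μ(Y)) - D(ρ‖σ)|³`, where `(X, Y)` has
law `jointProb`. -/
def absThirdMoment {ρ σ : Matrix ι ι ℂ} (hρ : ρ.IsHermitian) (hσ : σ.IsHermitian) : ℝ :=
  ∑ x, ∑ y, jointProb hρ hσ x y *
    |Real.log (hρ.eigenvalues x / hσ.eigenvalues y) - relEntropy ρ σ| ^ 3

/-! ### Hypothesis testing -/

/-- The `n`-fold tensor power `ρ^{⊗ n}`, in the product basis indexed by `Fin n → ι`. -/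
def tensorPower (n : ℕ) (ρ : Matrix ι ι ℂ) : Matrix (Fin n → ι) (Fin n → ι) ℂ :=
  Matrix.of fun x y => ∏ i, ρ (x i) (y i)

/-- Tests: matrices `A` with `0 ≤ A ≤ 1`, for the two-outcome measurement `(A, 1 - A)`. -/
def IsTest {κ : Type*} [Fintype κ] [DecidableEq κ] (A : Matrix κ κ ℂ) : Prop :=
  A.PosSemidef ∧ (1 - A).PosSemidef

/-- The error of the first kind `α_n(A) = Tr (ρ^{⊗ n} (1 - A))`. -/
def typeIError (ρ : Matrix ι ι ℂ) (n : ℕ) (A : Matrix (Fin n → ι) (Fin n → ι) ℂ) : ℝ :=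
  (tensorPower n ρ * (1 - A)).trace.re

/-- The error of the second kind `β_n(A) = Tr (σ^{⊗ n} A)`. -/
def typeIIError (σ : Matrix ι ι ℂ) (n : ℕ) (A : Matrix (Fin n → ι) (Fin n → ι) ℂ) : ℝ :=
  (tensorPower n σ * A).trace.re

/-- `β_n(ε)`: the minimal error of the second kind among the tests whose error of the first kind is
at most `ε` (see `isLeast_minTypeII`: for `ε ≥ 0` the infimum is a minimum). -/
def minTypeII (ρ σ : Matrix ι ι ℂ) (n : ℕ) (ε : ℝ) : ℝ :=
  sInf (typeIIError σ n '' {A | IsTest A ∧ typeIError ρ n A ≤ ε})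

section MinimumAttained

open scoped MatrixOrder Matrix.Norms.L2Operator

theorem isCompact_setOf_isTest {κ : Type*} [Fintype κ] [DecidableEq κ] :
    IsCompact {A : Matrix κ κ ℂ | IsTest A} := by
  have hset : {A : Matrix κ κ ℂ | IsTest A} = Set.Icc 0 1 := by
    ext A
    simp only [Set.mem_ofPred_eq, Set.mem_Icc, IsTest, Matrix.le_iff, sub_zero]
  have : ProperSpace (Matrix κ κ ℂ) := FiniteDimensional.proper ℂ _
  refine Metric.isCompact_of_isClosed_isBounded ?_ ?_
  · rw [hset]; exact isClosed_Icc
  · refine (Metric.isBounded_closedBall (x := (0 : Matrix κ κ ℂ)) (r := 1)).subset ?_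
    intro A hA
    rw [hset] at hA
    rw [mem_closedBall_zero_iff]
    exact (CStarAlgebra.norm_le_one_iff_of_nonneg A hA.1).2 hA.2

theorem isLeast_minTypeII (ρ σ : Matrix ι ι ℂ) (n : ℕ) {ε : ℝ} (hε : 0 ≤ ε) :
    IsLeast (typeIIError σ n '' {A | IsTest A ∧ typeIError ρ n A ≤ ε}) (minTypeII ρ σ n ε) := by
  refine IsCompact.isLeast_sInf ?_ ?_
  · refine IsCompact.image ?_ ?_
    · have hc : Continuous fun A => typeIError ρ n A := by
        unfold typeIError
        fun_prop
      exact isCompact_setOf_isTest.inter_right (isClosed_le hc continuous_const)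
    · unfold typeIIError
      fun_prop
  · refine ⟨_, 1, ⟨⟨Matrix.PosSemidef.one, ?_⟩, ?_⟩, rfl⟩
    · simpa using (Matrix.PosSemidef.zero : (0 : Matrix (Fin n → ι) (Fin n → ι) ℂ).PosSemidef)
    · simpa [typeIError] using hε

end MinimumAttained

end QHT

end

/-!
The error exponent is compared with the log-likelihood ratio `log (λ(X) / μ(Y))` of the joint
distribution `P(x, y) = λ(x) |⟨b_y | a_x⟩|²`, whose mean is `D`, whose variance is `V`
(`relEntropy_relVariance_eq`), and which tensorizes: for `ρ^{⊗ n}`, `σ^{⊗ n}` it becomes a sum of `n`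
independent copies. Two one-shot bounds reduce the quantum problem to the tail of that sum.

* Direct part (`exists_test`). For a threshold `L`, let `ξ_x` be the part of `a_x` in the span of the
  `b_y` with `L μ(y) ≤ λ(x)`, and let the test be the projection onto the span of all `ξ_x`. It
  detects `ρ` with probability at least `P(λ/μ ≥ L)`. Orthogonalizing in the order of increasing
  `λ(x)` keeps the `x`-th vector inside the span of the `b_y` with `L μ(y) ≤ λ(x)`, so its error of
  the second kind is at most `∑ λ(x) / L = 1 / L`.
* Converse part (`test_power_le`). Split `a_x` into the parts where `L μ(y)` is above and below the
  dyadic scale of `λ(x)`. The second part contributes at most `P(λ/μ > L)`. For the first, the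
  eigenvectors in one dyadic class are truncated by the same projection, so unitarity bounds the
  contribution of the class by a trace, and the classes sum up as a geometric series to at most
  `4 L β`, without any loss depending on the dimension or on `n`. The cross terms cost a factor
  `1 + t`, where `t = 1 / √n` is the right choice; this leads to `log (8 n)` in place of the larger
  `log (2 ^ 9 n ^ 2)`.

The Berry–Esseen constant is defined as an infimum of admissible constants, so it is a bound only
because some constant is admissible. This is the Berry–Esseen theorem
(`isBerryEsseenBound_hundred`). It is proved by Stein's method, by induction on the number of
variables: the solution `f` of `f' - x f = h - 𝔼 h(Z)` for a ramp `h` of width `α ≍ 𝔼|X|³ / √n` has a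
derivative that oscillates on the scale `α` only on an interval of length `α`; the probability that
the sum of `n - 1` variables lies in such an interval is known from the preceding step, and for `α`
large enough the recursion is contracting (`berry_esseen_step`).

The expansions in `n` follow since `Φ⁻¹` is Lipschitz near `ε` (`exists_normalQuantile_shift`), and
the exponent is finite for `ε < 1` since `supp ρ ⊆ supp σ` (`minTypeII_pos`).
-/

noncomputable section

namespace QHT

open scoped ComplexOrder

/-! ### The standard normal distribution function -/

theorem hasDerivAt_integral_Iic {g : ℝ → ℝ} (hg : Continuous g) (hi : Integrable g) (x : ℝ) :
    HasDerivAt (fun x => ∫ y in Set.Iic x, g y) (g x) x := by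
  have h1 : (fun x => ∫ y in Set.Iic x, g y)
      = fun x => (∫ y in Set.Iic (0 : ℝ), g y) + ∫ y in (0 : ℝ)..x, g y := by
    funext x
    rw [← intervalIntegral.integral_Iic_sub_Iic hi.integrableOn hi.integrableOn]
    ring
  rw [h1]
  exact (intervalIntegral.integral_hasDerivAt_right (hg.intervalIntegrable _ _)
    (hg.stronglyMeasurableAtFilter _ _) hg.continuousAt).const_add _

/-- The standard normal density. -/
def normalPDF (x : ℝ) : ℝ := gaussianPDFReal 0 1 x

theorem normalPDF_eq (x : ℝ) : normalPDF x = (√(2 * Real.pi))⁻¹ * Real.exp (-x ^ 2 / 2) := by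
  simp [normalPDF, gaussianPDFReal]

theorem normalPDF_pos (x : ℝ) : 0 < normalPDF x := gaussianPDFReal_pos 0 1 x one_ne_zero

theorem continuous_normalPDF : Continuous normalPDF := by
  have : normalPDF = fun x => (√(2 * Real.pi))⁻¹ * Real.exp (-x ^ 2 / 2) := funext normalPDF_eq
  rw [this]; fun_prop

theorem hasDerivAt_normalPDF (x : ℝ) : HasDerivAt normalPDF (-(x * normalPDF x)) x := by
  have : normalPDF = fun x => (√(2 * Real.pi))⁻¹ * Real.exp (-x ^ 2 / 2) := funext normalPDF_eq
  rw [this]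
  have h := (((hasDerivAt_pow 2 x).neg.div_const 2).exp).const_mul (√(2 * Real.pi))⁻¹
  refine h.congr_deriv ?_
  simp
  ring

theorem integrable_normalPDF : Integrable normalPDF := integrable_gaussianPDFReal 0 1

theorem integral_normalPDF : ∫ x, normalPDF x = 1 := integral_gaussianPDFReal_eq_one 0 one_ne_zero

theorem two_lt_sqrt_two_pi : 2 < √(2 * Real.pi) := by
  apply Real.lt_sqrt_of_sq_lt
  nlinarith [Real.pi_gt_three]

theorem normalPDF_le (x : ℝ) : normalPDF x ≤ 1 / 2 := by
  rw [normalPDF_eq]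
  have h1 : Real.exp (-x ^ 2 / 2) ≤ 1 := Real.exp_le_one_iff.2 (by nlinarith [sq_nonneg x])
  have h2 : (√(2 * Real.pi))⁻¹ ≤ 1 / 2 := by
    rw [one_div]
    exact inv_anti₀ two_pos two_lt_sqrt_two_pi.le
  calc _ ≤ (1 / 2 : ℝ) * 1 := mul_le_mul h2 h1 (Real.exp_pos _).le (by norm_num)
    _ = 1 / 2 := mul_one _

theorem normalPDF_neg (x : ℝ) : normalPDF (-x) = normalPDF x := by
  simp [normalPDF_eq]

theorem gaussianReal_real_eq_integral (s : Set ℝ) :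
    (gaussianReal 0 1).real s = ∫ x in s, normalPDF x := by
  rw [measureReal_def, gaussianReal_apply_eq_integral 0 one_ne_zero, ENNReal.toReal_ofReal]
  · rfl
  · exact integral_nonneg fun x => (normalPDF_pos x).le

theorem normalCDF_eq_integral (x : ℝ) : normalCDF x = ∫ y in Set.Iic x, normalPDF y := by
  rw [normalCDF, cdf_eq_real, gaussianReal_real_eq_integral]

theorem one_sub_normalCDF_eq_integral (x : ℝ) :
    1 - normalCDF x = ∫ y in Set.Ioi x, normalPDF y := by
  rw [normalCDF_eq_integral, ← integral_normalPDF,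
    ← integral_add_compl (measurableSet_Iic (a := x)) integrable_normalPDF, Set.compl_Iic]
  ring

theorem hasDerivAt_normalCDF (x : ℝ) : HasDerivAt normalCDF (normalPDF x) x := by
  have : normalCDF = fun x => ∫ y in Set.Iic x, normalPDF y := funext normalCDF_eq_integral
  rw [this]
  exact hasDerivAt_integral_Iic continuous_normalPDF integrable_normalPDF x

theorem continuous_normalCDF : Continuous normalCDF :=
  continuous_iff_continuousAt.2 fun x => (hasDerivAt_normalCDF x).continuousAt

theorem strictMono_normalCDF : StrictMono normalCDF :=
  strictMono_of_hasDerivAt_pos hasDerivAt_normalCDF normalPDF_pos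

theorem normalCDF_neg (x : ℝ) : normalCDF (-x) = 1 - normalCDF x := by
  rw [one_sub_normalCDF_eq_integral, normalCDF_eq_integral]
  have := integral_comp_neg_Iic (-x) normalPDF
  simpa [normalPDF_neg] using this

theorem normalCDF_pos (x : ℝ) : 0 < normalCDF x :=
  (cdf_nonneg _ (x - 1)).trans_lt (strictMono_normalCDF (by linarith))

theorem normalCDF_lt_one (x : ℝ) : normalCDF x < 1 :=
  (strictMono_normalCDF (by linarith : x < x + 1)).trans_le (cdf_le_one _ _)

theorem normalCDF_sub_le {a b : ℝ} (hab : a ≤ b) : normalCDF b - normalCDF a ≤ (b - a) / 2 := by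
  have := (convex_univ : Convex ℝ (Set.univ : Set ℝ)).image_sub_le_mul_sub_of_deriv_le
    (f := normalCDF) (C := 1 / 2) continuous_normalCDF.continuousOn
    (fun x _ => (hasDerivAt_normalCDF x).differentiableAt.differentiableWithinAt)
    (fun x _ => by rw [(hasDerivAt_normalCDF x).deriv]; exact normalPDF_le x)
    a trivial b trivial hab
  linarith

/-- The Mills ratio bound. -/
theorem mul_one_sub_normalCDF_le {x : ℝ} (hx : 0 ≤ x) : x * (1 - normalCDF x) ≤ normalPDF x := by
  have hd : ∀ y ∈ Set.Ici x, HasDerivAt (fun y => -normalPDF y) (y * normalPDF y) y :=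
    fun y _ => by rw [← neg_neg (y * normalPDF y)]; exact (hasDerivAt_normalPDF y).fun_neg
  have hlim : Tendsto (fun y => -normalPDF y) atTop (nhds 0) := by
    have : normalPDF = fun x => (√(2 * Real.pi))⁻¹ * Real.exp (-x ^ 2 / 2) := funext normalPDF_eq
    rw [this, ← neg_zero, ← mul_zero (√(2 * Real.pi))⁻¹]
    refine (Tendsto.const_mul _ (Real.tendsto_exp_atBot.comp ?_)).neg
    have h2 : Tendsto (fun y : ℝ => y ^ 2 / 2) atTop atTop :=
      (tendsto_pow_atTop two_ne_zero).atTop_div_const two_pos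
    refine (tendsto_neg_atTop_atBot.comp h2).congr fun y => ?_
    simp only [Function.comp]
    ring
  have hnn : ∀ y ∈ Set.Ioi x, 0 ≤ y * normalPDF y := fun y hy =>
    mul_nonneg (hx.trans (le_of_lt hy)) (normalPDF_pos y).le
  have hd' : ∀ y ∈ Set.Ioi x, HasDerivAt (fun y => -normalPDF y) (y * normalPDF y) y :=
    fun y hy => hd y (Set.Ioi_subset_Ici_self hy)
  have hc : ContinuousWithinAt (fun y => -normalPDF y) (Set.Ici x) x :=
    continuous_normalPDF.neg.continuousWithinAt
  have hint := integrableOn_Ioi_deriv_of_nonneg hc hd' hnn hlim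
  have heq := integral_Ioi_of_hasDerivAt_of_nonneg hc hd' hnn hlim
  rw [one_sub_normalCDF_eq_integral, ← integral_const_mul]
  calc ∫ y in Set.Ioi x, x * normalPDF y ≤ ∫ y in Set.Ioi x, y * normalPDF y :=
        setIntegral_mono_on (integrable_normalPDF.integrableOn.const_mul x) hint measurableSet_Ioi
          fun y hy => mul_le_mul_of_nonneg_right (le_of_lt hy) (normalPDF_pos y).le
    _ = normalPDF x := by rw [heq]; ring

/-! ### The quantile function -/

theorem exists_normalCDF_eq {p : ℝ} (h0 : 0 < p) (h1 : p < 1) : ∃ x, normalCDF x = p := by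
  have := mem_range_of_exists_le_of_exists_ge continuous_normalCDF
    ((tendsto_cdf_atBot (gaussianReal 0 1)).eventually_le_const h0).exists
    ((tendsto_cdf_atTop (gaussianReal 0 1)).eventually_const_le h1).exists
  exact this

theorem le_normalQuantile {p x : ℝ} (h : normalCDF x ≤ p) : (x : EReal) ≤ normalQuantile p :=
  le_sSup ⟨x, h, rfl⟩

theorem normalQuantile_normalCDF (x : ℝ) : normalQuantile (normalCDF x) = x := by
  refine le_antisymm (sSup_le ?_) (le_normalQuantile le_rfl)
  rintro _ ⟨y, hy, rfl⟩
  exact EReal.coe_le_coe_iff.2 (strictMono_normalCDF.le_iff_le.1 hy)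

theorem normalQuantile_of_nonpos {p : ℝ} (hp : p ≤ 0) : normalQuantile p = ⊥ := by
  have : {x : ℝ | normalCDF x ≤ p} = ∅ :=
    Set.eq_empty_of_forall_notMem fun x hx => absurd (normalCDF_pos x) (not_lt.2 (hx.trans hp))
  rw [normalQuantile, this, Set.image_empty, sSup_empty]

/-- Shifting the argument of `Φ⁻¹` by `c / √n` changes its value by `O(1 / √n)`: the density of the
normal distribution is bounded below near `Φ⁻¹ ε`. -/
theorem exists_normalQuantile_shift {ε : ℝ} (h0 : 0 < ε) (h1 : ε < 1) (c : ℝ) :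
    ∃ q : ℝ, normalQuantile ε = q ∧ ∃ s : ℕ → ℝ, (∃ K : ℝ, ∀ᶠ n : ℕ in atTop, |√n * s n| ≤ K) ∧
      ∀ᶠ n : ℕ in atTop, normalQuantile (ε + c / √n) = ((q + s n : ℝ) : EReal) := by
  obtain ⟨q, rfl⟩ := exists_normalCDF_eq h0 h1
  refine ⟨q, normalQuantile_normalCDF q, fun n => (normalQuantile (normalCDF q + c / √n)).toReal - q,
    ?_⟩
  obtain ⟨z, -, hz⟩ := isCompact_Icc.exists_isMinOn (α := ℝ) (s := Set.Icc (q - 1) (q + 1))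
    ⟨q, by constructor <;> linarith⟩ continuous_normalPDF.continuousOn
  set m := normalPDF z with hm
  have hmpos : 0 < m := normalPDF_pos z
  have hincr : ∀ a ∈ Set.Icc (q - 1) (q + 1), ∀ b ∈ Set.Icc (q - 1) (q + 1), a ≤ b →
      m * (b - a) ≤ normalCDF b - normalCDF a := by
    refine (convex_Icc _ _).mul_sub_le_image_sub_of_le_deriv continuous_normalCDF.continuousOn
      (fun x _ => (hasDerivAt_normalCDF x).differentiableAt.differentiableWithinAt) fun x hx => ?_
    rw [(hasDerivAt_normalCDF x).deriv]
    exact hz (interior_subset hx)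
  have hsq : Tendsto (fun n : ℕ => √(n : ℝ)) atTop atTop :=
    Real.tendsto_sqrt_atTop.comp tendsto_natCast_atTop_atTop
  have hlarge : ∀ᶠ n : ℕ in atTop, |c| / m < √(n : ℝ) ∧ 0 < √(n : ℝ) :=
    (hsq.eventually_gt_atTop _).and (hsq.eventually_gt_atTop 0)
  have key : ∀ᶠ n : ℕ in atTop, 0 < √(n : ℝ) ∧
      ∃ x : ℝ, normalCDF x = normalCDF q + c / √n ∧ m * |x - q| ≤ |c| / √n := by
    filter_upwards [hlarge] with n hn
    refine ⟨hn.2, ?_⟩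
    have hcm : |c| / √n < m := by
      rw [div_lt_iff₀ hn.2]; rw [div_lt_iff₀ hmpos] at hn; linarith [hn.1]
    have habs : |c / √n| = |c| / √n := by rw [abs_div, abs_of_pos hn.2]
    have hc' := abs_le.1 habs.le
    have hlo := hincr (q - 1) ⟨by linarith, by linarith⟩ q ⟨by linarith, by linarith⟩ (by linarith)
    have hhi := hincr q ⟨by linarith, by linarith⟩ (q + 1) ⟨by linarith, by linarith⟩ (by linarith)
    obtain ⟨x, hx, hxe⟩ := intermediate_value_Icc (by linarith : q - 1 ≤ q + 1)
      continuous_normalCDF.continuousOn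
      (show normalCDF q + c / √n ∈ Set.Icc _ _ from ⟨by linarith, by linarith⟩)
    refine ⟨x, hxe, ?_⟩
    have hq : q ∈ Set.Icc (q - 1) (q + 1) := ⟨by linarith, by linarith⟩
    rcases le_total q x with h | h
    · rw [abs_of_nonneg (sub_nonneg.2 h)]
      linarith [hincr q hq x hx h]
    · rw [abs_sub_comm, abs_of_nonneg (sub_nonneg.2 h)]
      linarith [hincr x hx q hq h]
  constructor
  · refine ⟨|c| / m, ?_⟩
    filter_upwards [key] with n ⟨hn, x, hx, hle⟩
    rw [← hx, normalQuantile_normalCDF, EReal.toReal_coe, abs_mul, abs_of_pos hn, le_div_iff₀ hmpos]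
    rw [le_div_iff₀ hn] at hle
    linarith
  · filter_upwards [key] with n ⟨hn, x, hx, hle⟩
    rw [← hx, normalQuantile_normalCDF, EReal.toReal_coe, add_sub_cancel]

/-! ### Stein's equation -/

/-- **Stein's equation** `f' - x f = h - 𝔼 h(Z)`, `Z` standard normal, has a solution for which
`f` and `x f` are bounded. The solution is `f = F / φ` with
`F(x) = ∫ y in (-∞, x], (h y - 𝔼 h(Z)) φ(y)`, and the bounds follow from
`|F| ≤ min (Φ, 1 - Φ)` and the Mills ratio. -/
theorem exists_stein_solution {h : ℝ → ℝ} (hc : Continuous h) (h0 : ∀ x, 0 ≤ h x)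
    (h1 : ∀ x, h x ≤ 1) :
    ∃ f : ℝ → ℝ, (∀ x, HasDerivAt f (x * f x + (h x - ∫ y, h y ∂gaussianReal 0 1)) x) ∧
      (∀ x, |f x| ≤ 5) ∧ ∀ x, |x * f x| ≤ 1 := by
  set N := ∫ y, h y ∂gaussianReal 0 1 with hN
  have hhi : Integrable h (gaussianReal 0 1) :=
    Integrable.of_bound hc.aestronglyMeasurable 1
      (Eventually.of_forall fun x => by rw [Real.norm_eq_abs, abs_of_nonneg (h0 x)]; exact h1 x)
  have hN0 : 0 ≤ N := integral_nonneg h0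
  have hN1 : N ≤ 1 := by
    calc N ≤ ∫ _, (1 : ℝ) ∂gaussianReal 0 1 := integral_mono hhi (integrable_const _) h1
      _ = 1 := by simp
  have hNd : N = ∫ y, h y * normalPDF y := by
    rw [hN, integral_gaussianReal_eq_integral_smul one_ne_zero]
    exact integral_congr_ae (Eventually.of_forall fun x => by simp [normalPDF, mul_comm])
  have hcg : Continuous fun y => (h y - N) * normalPDF y :=
    (hc.sub continuous_const).mul continuous_normalPDF
  have hhp : Integrable fun y => h y * normalPDF y :=
    integrable_normalPDF.bdd_mul (c := 1) hc.aestronglyMeasurable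
      (Eventually.of_forall fun x => by rw [Real.norm_eq_abs, abs_of_nonneg (h0 x)]; exact h1 x)
  have hig : Integrable fun y => (h y - N) * normalPDF y := by
    simp only [sub_mul]
    exact hhp.sub (integrable_normalPDF.const_mul N)
  have htot : ∫ y, (h y - N) * normalPDF y = 0 := by
    simp only [sub_mul]
    rw [integral_sub hhp (integrable_normalPDF.const_mul N), integral_const_mul,
      integral_normalPDF, ← hNd]
    ring
  have hle : ∀ y, |(h y - N) * normalPDF y| ≤ normalPDF y := fun y => by
    rw [abs_mul, abs_of_pos (normalPDF_pos y)]
    refine mul_le_of_le_one_left (normalPDF_pos y).le (abs_le.2 ?_)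
    constructor <;> linarith [h0 y, h1 y]
  set F : ℝ → ℝ := fun x => ∫ y in Set.Iic x, (h y - N) * normalPDF y with hF
  have hset : ∀ s : Set ℝ, |∫ y in s, (h y - N) * normalPDF y| ≤ ∫ y in s, normalPDF y := fun s =>
    (abs_integral_le_integral_abs).trans
      (integral_mono hig.abs.integrableOn integrable_normalPDF.integrableOn hle)
  have hF1 : ∀ x, |F x| ≤ normalCDF x := fun x => by
    rw [normalCDF_eq_integral]; exact hset _
  have hF2 : ∀ x, |F x| ≤ 1 - normalCDF x := fun x => by
    have : F x = -∫ y in Set.Ioi x, (h y - N) * normalPDF y := by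
      have := integral_add_compl (measurableSet_Iic (a := x)) hig
      rw [htot, Set.compl_Iic] at this
      linarith
    rw [this, abs_neg, one_sub_normalCDF_eq_integral]; exact hset _
  have hxF : ∀ x, |x * F x| ≤ normalPDF x := fun x => by
    rw [abs_mul]
    rcases le_total 0 x with hx | hx
    · rw [abs_of_nonneg hx]
      exact (mul_le_mul_of_nonneg_left (hF2 x) hx).trans (mul_one_sub_normalCDF_le hx)
    · rw [abs_of_nonpos hx, ← normalPDF_neg]
      refine (mul_le_mul_of_nonneg_left (hF1 x) (neg_nonneg.2 hx)).trans ?_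
      have := mul_one_sub_normalCDF_le (neg_nonneg.2 hx)
      rwa [normalCDF_neg, sub_sub_cancel] at this
  have hxf : ∀ x, |x * (F x / normalPDF x)| ≤ 1 := fun x => by
    rw [← mul_div_assoc, abs_div, abs_of_pos (normalPDF_pos x), div_le_one (normalPDF_pos x)]
    exact hxF x
  refine ⟨fun x => F x / normalPDF x, fun x => ?_, fun x => ?_, hxf⟩
  · have hd := (hasDerivAt_integral_Iic hcg hig x).div (hasDerivAt_normalPDF x)
      (normalPDF_pos x).ne'
    refine hd.congr_deriv ?_
    have := (normalPDF_pos x).ne'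
    simp only [hF]
    field_simp
    ring
  · rcases le_total 1 |x| with hx | hx
    · have := hxf x
      rw [abs_mul] at this
      nlinarith [abs_nonneg (F x / normalPDF x)]
    · rw [abs_div, abs_of_pos (normalPDF_pos x), div_le_iff₀ (normalPDF_pos x)]
      have hF' : |F x| ≤ 1 / 2 := by linarith [hF1 x, hF2 x]
      have hx2 : x ^ 2 ≤ 1 := by
        rw [← sq_abs]; exact pow_le_one₀ (abs_nonneg x) hx
      have hs : √(2 * Real.pi) ≤ 3 := by
        rw [Real.sqrt_le_left (by norm_num)]
        nlinarith [Real.pi_lt_d2]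
      have he : 1 / 2 ≤ Real.exp (-x ^ 2 / 2) := by
        have := Real.add_one_le_exp (-x ^ 2 / 2)
        linarith
      have hi : 1 / 3 ≤ (√(2 * Real.pi))⁻¹ := by
        rw [one_div]
        exact inv_anti₀ (by linarith [two_lt_sqrt_two_pi]) hs
      have : 1 / 3 * (1 / 2) ≤ normalPDF x := by
        rw [normalPDF_eq]
        exact mul_le_mul hi he (by norm_num) (by linarith)
      linarith

/-! ### The Berry–Esseen theorem -/

/-- The continuous function which is `1` up to `z`, `0` from `z + α` on, and affine in between. -/
def ramp (z α x : ℝ) : ℝ := max 0 (min 1 ((z + α - x) / α))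

theorem continuous_ramp (z α : ℝ) : Continuous (ramp z α) := by
  unfold ramp; fun_prop

theorem ramp_nonneg (z α x : ℝ) : 0 ≤ ramp z α x := le_max_left _ _

theorem ramp_le_one (z α x : ℝ) : ramp z α x ≤ 1 := max_le zero_le_one (min_le_left _ _)

theorem ramp_of_le {z α x : ℝ} (hα : 0 < α) (h : x ≤ z) : ramp z α x = 1 := by
  have : 1 ≤ (z + α - x) / α := by rw [le_div_iff₀ hα]; linarith
  rw [ramp, min_eq_left this, max_eq_right zero_le_one]

theorem ramp_of_ge {z α x : ℝ} (hα : 0 < α) (h : z + α ≤ x) : ramp z α x = 0 :=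
  max_eq_left ((min_le_right _ _).trans (div_nonpos_of_nonpos_of_nonneg (by linarith) hα.le))

theorem abs_ramp_sub_le (z : ℝ) {α : ℝ} (hα : 0 < α) (x y : ℝ) :
    |ramp z α x - ramp z α y| ≤ |x - y| / α := by
  unfold ramp
  refine (abs_max_sub_max_le_max _ _ _ _).trans (max_le (by simp; positivity) ?_)
  refine (abs_min_sub_min_le_max _ _ _ _).trans (max_le (by simp; positivity) ?_)
  rw [← sub_div, abs_div, abs_of_pos hα, abs_sub_comm x y]
  rw [show z + α - x - (z + α - y) = y - x by ring]

theorem abs_ramp_sub_le_one (z α x y : ℝ) : |ramp z α x - ramp z α y| ≤ 1 := by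
  rw [abs_le]
  constructor <;>
  linarith [ramp_nonneg z α x, ramp_nonneg z α y, ramp_le_one z α x, ramp_le_one z α y]

/-- If `W` charges intervals of length `l` by at most `2 δ + l`, then `t ↦ 𝔼 h(W + t)`, for a ramp
`h` of width `α`, varies slower than `h` itself: the slope is `O(1)` as soon as `δ = O(α)`. -/
theorem abs_integral_ramp_sub_le {ν : Measure ℝ} [IsProbabilityMeasure ν] {δ α : ℝ} (hα : 0 < α)
    (hδ : 0 ≤ δ) (hν : ∀ a b, a ≤ b → ν.real (Set.Ioc a b) ≤ 2 * δ + (b - a)) (z t : ℝ) :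
    |∫ w, (ramp z α (w + t) - ramp z α w) ∂ν| ≤ (2 * δ / α + 2) * |t| := by
  set I : Set ℝ := Set.Ioc (z - max t 0) (z + α + max (-t) 0) with hI
  have hlen : z + α + max (-t) 0 - (z - max t 0) = α + |t| := by
    have : max t 0 + max (-t) 0 = |t| := by
      rcases le_total 0 t with h | h
      · rw [max_eq_left h, max_eq_right (by linarith), abs_of_nonneg h, add_zero]
      · rw [max_eq_right h, max_eq_left (by linarith), abs_of_nonpos h, zero_add]
    linarith
  set c := min 1 (|t| / α) with hcdef
  have hc0 : 0 ≤ c := le_min zero_le_one (by positivity)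
  have hpt : ∀ w, |ramp z α (w + t) - ramp z α w| ≤ I.indicator (fun _ => c) w := fun w => by
    by_cases hw : w ∈ I
    · rw [Set.indicator_of_mem hw]
      refine le_min (abs_ramp_sub_le_one _ _ _ _) ?_
      have := abs_ramp_sub_le z hα (w + t) w
      rwa [add_sub_cancel_left] at this
    · rw [Set.indicator_of_notMem hw]
      rw [hI, Set.mem_Ioc, not_and_or, not_lt, not_le] at hw
      have h1 := le_max_left t 0
      have h2 := le_max_right t 0
      have h3 := le_max_left (-t) 0
      have h4 := le_max_right (-t) 0
      rcases hw with hw | hw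
      · rw [ramp_of_le hα (by linarith), ramp_of_le hα (by linarith)]; simp
      · rw [ramp_of_ge hα (by linarith), ramp_of_ge hα (by linarith)]; simp
  have hIm : MeasurableSet I := measurableSet_Ioc
  have hb : ν.real I ≤ 2 * δ + (α + |t|) := by
    rw [← hlen]
    exact hν _ _ (by linarith [hlen, abs_nonneg t])
  calc |∫ w, (ramp z α (w + t) - ramp z α w) ∂ν|
      ≤ ∫ w, |ramp z α (w + t) - ramp z α w| ∂ν := abs_integral_le_integral_abs
    _ ≤ ∫ w, I.indicator (fun _ => c) w ∂ν := by
        refine integral_mono_of_nonneg (Eventually.of_forall fun _ => abs_nonneg _)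
          ((integrable_const c).indicator hIm) (Eventually.of_forall hpt)
    _ = c * ν.real I := by rw [integral_indicator_const _ hIm, smul_eq_mul, mul_comm]
    _ ≤ c * (2 * δ + (α + |t|)) := by gcongr
    _ = c * (2 * δ + α) + c * |t| := by ring
    _ ≤ |t| / α * (2 * δ + α) + 1 * |t| := by
        gcongr
        · exact min_le_right _ _
        · exact min_le_left _ _
    _ = (2 * δ / α + 2) * |t| := by field_simp; ring

/-- Averaging the solution `f` of Stein's equation for a ramp over `W` gives a `C¹` function with a
Lipschitz derivative; its Lipschitz constant is `O(1 + δ / α)`. -/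
theorem stein_solution_average {ν : Measure ℝ} [IsProbabilityMeasure ν] {δ α z N : ℝ} (hα : 0 < α)
    (hδ : 0 ≤ δ) (hν : ∀ a b, a ≤ b → ν.real (Set.Ioc a b) ≤ 2 * δ + (b - a))
    (hid : Integrable (fun w : ℝ => w) ν) (habs : ∫ w, |w| ∂ν ≤ 1) (hN0 : 0 ≤ N) (hN1 : N ≤ 1)
    {f : ℝ → ℝ} (hf : ∀ x, HasDerivAt f (x * f x + (ramp z α x - N)) x) (hf5 : ∀ x, |f x| ≤ 5)
    (hxf : ∀ x, |x * f x| ≤ 1) (t : ℝ) :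
    |(∫ w, ((w + t) * f (w + t) + (ramp z α (w + t) - N)) ∂ν)
        - ∫ w, (w * f w + (ramp z α w - N)) ∂ν| ≤ (2 * δ / α + 9) * |t| ∧
    |(∫ w, f (w + t) ∂ν) - (∫ w, f w ∂ν) - t * ∫ w, (w * f w + (ramp z α w - N)) ∂ν|
      ≤ (2 * δ / α + 9) * t ^ 2 := by
  have hfc : Continuous f := continuous_iff_continuousAt.2 fun x => (hf x).continuousAt
  set d : ℝ → ℝ := fun x => x * f x + (ramp z α x - N) with hd
  have hdc : Continuous d := (continuous_id.mul hfc).add ((continuous_ramp z α).sub continuous_const)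
  have hd2 : ∀ x, |d x| ≤ 2 := fun x => by
    have h1 : |ramp z α x - N| ≤ 1 := abs_le.2
      ⟨by linarith [ramp_nonneg z α x], by linarith [ramp_le_one z α x]⟩
    exact (abs_add_le _ _).trans (by linarith [hxf x])
  have hib : ∀ (u : ℝ → ℝ) (c : ℝ), Continuous u → (∀ x, |u x| ≤ c) → Integrable u ν :=
    fun u c hu hc => Integrable.of_bound hu.aestronglyMeasurable c (Eventually.of_forall hc)
  have hmv : ∀ x y, |f y - f x| ≤ 2 * |y - x| := fun x y =>
    (convex_univ : Convex ℝ (Set.univ : Set ℝ)).norm_image_sub_le_of_norm_hasDerivWithin_le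
      (fun x _ => (hf x).hasDerivWithinAt) (fun x _ => hd2 x) trivial trivial
  have hshift : ∀ t, Continuous fun w : ℝ => w + t := fun t => continuous_id.add continuous_const
  have hxf_int : ∀ t, Integrable (fun w => (w + t) * f (w + t)) ν := fun t =>
    hib _ 1 ((hshift t).mul (hfc.comp (hshift t))) fun w => hxf _
  have hr_int : ∀ t, Integrable (fun w => ramp z α (w + t)) ν := fun t =>
    hib _ 1 ((continuous_ramp z α).comp (hshift t)) fun w => by
      rw [abs_of_nonneg (ramp_nonneg _ _ _)]; exact ramp_le_one _ _ _
  have hpt : ∀ t w, |(w + t) * f (w + t) - w * f w| ≤ 5 * |t| + 2 * |t| * |w| := fun t w => by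
    have e : (w + t) * f (w + t) - w * f w = t * f (w + t) + w * (f (w + t) - f w) := by ring
    rw [e]
    refine (abs_add_le _ _).trans ?_
    rw [abs_mul, abs_mul]
    have h1 := hmv w (w + t)
    rw [add_sub_cancel_left] at h1
    nlinarith [mul_le_mul_of_nonneg_left (hf5 (w + t)) (abs_nonneg t),
      mul_le_mul_of_nonneg_left h1 (abs_nonneg w)]
  have hd_int : ∀ t, Integrable (fun w => d (w + t)) ν := fun t =>
    hib _ 2 (hdc.comp (hshift t)) fun w => hd2 _
  have hxf_int0 : Integrable (fun w => w * f w) ν := by simpa using hxf_int 0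
  have hr_int0 : Integrable (fun w => ramp z α w) ν := by simpa using hr_int 0
  have hLip : ∀ t, |(∫ w, d (w + t) ∂ν) - ∫ w, d w ∂ν| ≤ (2 * δ / α + 9) * |t| := fun t => by
    have e : (∫ w, d (w + t) ∂ν) - ∫ w, d w ∂ν
        = (∫ w, ((w + t) * f (w + t) - w * f w) ∂ν)
          + ∫ w, (ramp z α (w + t) - ramp z α w) ∂ν := by
      rw [← integral_sub (hd_int t) (hib _ 2 hdc hd2),
        ← integral_add
          (show Integrable (fun w => (w + t) * f (w + t) - w * f w) ν from (hxf_int t).sub hxf_int0)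
          (show Integrable (fun w => ramp z α (w + t) - ramp z α w) ν from (hr_int t).sub hr_int0)]
      refine integral_congr_ae (Eventually.of_forall fun w => ?_)
      simp only [hd]
      ring
    have h1 : |∫ w, ((w + t) * f (w + t) - w * f w) ∂ν| ≤ 7 * |t| := by
      calc _ ≤ ∫ w, |(w + t) * f (w + t) - w * f w| ∂ν := abs_integral_le_integral_abs
        _ ≤ ∫ w, (5 * |t| + 2 * |t| * |w|) ∂ν :=
            integral_mono ((hxf_int t).sub hxf_int0).abs
              ((integrable_const _).add (hid.abs.const_mul _)) (hpt t)
        _ = 5 * |t| + 2 * |t| * ∫ w, |w| ∂ν := by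
            rw [integral_add (integrable_const _) (hid.abs.const_mul _), integral_const_mul,
              integral_const_mul]
            simp
        _ ≤ 7 * |t| := by nlinarith [abs_nonneg t]
    rw [e]
    refine (abs_add_le _ _).trans ?_
    linarith [abs_integral_ramp_sub_le hα hδ hν z t]
  refine ⟨hLip t, ?_⟩
  have hder : ∀ s, HasDerivAt (fun s => ∫ w, f (w + s) ∂ν) (∫ w, d (w + s) ∂ν) s := fun s =>
    (hasDerivAt_integral_of_dominated_loc_of_deriv_le (F := fun s w => f (w + s))
      (F' := fun s w => d (w + s)) (bound := fun _ => 2) univ_mem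
      (Eventually.of_forall fun s => (hfc.comp (hshift s)).aestronglyMeasurable)
      (hib _ 5 (hfc.comp (hshift s)) fun w => hf5 _) (hdc.comp (hshift s)).aestronglyMeasurable
      (Eventually.of_forall fun w s _ => hd2 _) (integrable_const _)
      (Eventually.of_forall fun w s _ => by
        simpa using (hf (w + s)).comp_const_add w s)).2
  have hder' : ∀ s, HasDerivAt (fun s => (∫ w, f (w + s) ∂ν) - s * ∫ w, d w ∂ν)
      ((∫ w, d (w + s) ∂ν) - ∫ w, d w ∂ν) s := fun s => by
    simpa using (hder s).fun_sub ((hasDerivAt_id' s).mul_const (∫ w, d w ∂ν))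
  have hA : 0 ≤ 2 * δ / α + 9 := by positivity
  have := (convex_uIcc (0 : ℝ) t).norm_image_sub_le_of_norm_hasDerivWithin_le
    (C := (2 * δ / α + 9) * |t|)
    (fun s _ => (hder' s).hasDerivWithinAt) (fun s hs => (hLip s).trans (by
      refine mul_le_mul_of_nonneg_left ?_ hA
      have := Set.abs_sub_left_of_mem_uIcc hs
      simpa using this)) Set.left_mem_uIcc Set.right_mem_uIcc
  simp only [Real.norm_eq_abs, add_zero, zero_mul, sub_zero] at this
  rw [sub_right_comm]
  refine this.trans (le_of_eq ?_)
  rw [mul_assoc, ← abs_mul, ← pow_two, abs_of_nonneg (sq_nonneg t)]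

/-- Integrating a function of one coordinate and of the sum of all of them. -/
theorem integral_pi_coord_sum (Q : Measure ℝ) [IsProbabilityMeasure Q] {m : ℕ} (i : Fin (m + 1))
    {F : ℝ → ℝ → ℝ} (hF : Continuous (Function.uncurry F)) {c : ℝ} (hc : ∀ x s, |F x s| ≤ c * (1 + |x|))
    (hQ : Integrable (fun x : ℝ => x) Q) :
    Integrable (fun ω => F (ω i) (∑ j, ω j)) (Measure.pi fun _ : Fin (m + 1) => Q) ∧
    Integrable (fun x => ∫ ω, F x (x + ∑ j, ω j) ∂(Measure.pi fun _ : Fin m => Q)) Q ∧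
    ∫ ω, F (ω i) (∑ j, ω j) ∂(Measure.pi fun _ : Fin (m + 1) => Q)
      = ∫ x, ∫ ω, F x (x + ∑ j, ω j) ∂(Measure.pi fun _ : Fin m => Q) ∂Q := by
  have hmp := measurePreserving_piFinSuccAbove (fun _ : Fin (m + 1) => Q) i
  set G : ℝ × (Fin m → ℝ) → ℝ := fun p => F p.1 (p.1 + ∑ j, p.2 j) with hG
  have hGc : Continuous G := hF.comp (by fun_prop : Continuous
    fun p : ℝ × (Fin m → ℝ) => (p.1, p.1 + ∑ j, p.2 j))
  have hGi : Integrable G (Q.prod (Measure.pi fun _ : Fin m => Q)) := by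
    refine Integrable.mono' ((((integrable_const (1 : ℝ)).add hQ.abs).const_mul c).comp_fst _) hGc.aestronglyMeasurable
      (Eventually.of_forall fun p => hc _ _)
  have hcomp : (fun ω : Fin (m + 1) → ℝ => F (ω i) (∑ j, ω j))
      = G ∘ MeasurableEquiv.piFinSuccAbove (fun _ => ℝ) i := by
    funext ω
    simp [hG, Fin.sum_univ_succAbove _ i, Fin.removeNth]
  rw [hcomp]
  refine ⟨hmp.integrable_comp_of_integrable hGi, hGi.integral_prod_left, ?_⟩
  have := hmp.integral_comp' G
  rw [← integral_prod _ hGi, ← this]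
  rfl

/-- The mean of a ramp lies between the values of the distribution function at its two ends. -/
theorem integral_ramp_bounds {Ω : Type*} [MeasurableSpace Ω] (μ : Measure Ω)
    [IsProbabilityMeasure μ] {W : Ω → ℝ} (hW : Measurable W) (z : ℝ) {α : ℝ} (hα : 0 < α) :
    μ.real {ω | W ω ≤ z} ≤ ∫ ω, ramp z α (W ω) ∂μ ∧
      ∫ ω, ramp z α (W ω) ∂μ ≤ μ.real {ω | W ω ≤ z + α} := by
  have hi : Integrable (fun ω => ramp z α (W ω)) μ :=
    Integrable.of_bound ((continuous_ramp z α).measurable.comp hW).aestronglyMeasurable 1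
      (Eventually.of_forall fun x => by
        rw [Real.norm_eq_abs, abs_of_nonneg (ramp_nonneg _ _ _)]; exact ramp_le_one _ _ _)
  have hm : ∀ y, MeasurableSet {ω | W ω ≤ y} := fun y => measurableSet_le hW measurable_const
  constructor
  · rw [← integral_indicator_one (hm z)]
    refine integral_mono ((integrable_const 1).indicator (hm z)) hi fun ω => ?_
    by_cases h : W ω ≤ z
    · simp [Set.indicator, h, ramp_of_le hα h]
    · simp [Set.indicator, h, ramp_nonneg]
  · rw [← integral_indicator_one (hm (z + α))]
    refine integral_mono hi ((integrable_const 1).indicator (hm _)) fun ω => ?_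
    by_cases h : W ω ≤ z + α
    · simp [Set.indicator, h, ramp_le_one]
    · simp [Set.indicator, h, ramp_of_ge hα (not_le.1 h).le]

theorem normalCDF_eq_real (x : ℝ) : normalCDF x = (gaussianReal 0 1).real {y | y ≤ x} :=
  cdf_eq_real _ _

section Standardized

variable {Q : Measure ℝ} [IsProbabilityMeasure Q]

theorem integrable_abs_pow_of_cube (h3 : Integrable (fun x => |x| ^ 3) Q) :
    Integrable (fun x : ℝ => x) Q ∧ Integrable (fun x : ℝ => x ^ 2) Q := by
  have hd : Integrable (fun x : ℝ => 1 + |x| ^ 3) Q := (integrable_const _).add h3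
  constructor
  · refine hd.mono' measurable_id.aestronglyMeasurable (Eventually.of_forall fun x => ?_)
    rw [Real.norm_eq_abs]
    have := abs_nonneg x
    nlinarith [mul_nonneg this (sq_nonneg (|x| - 1)), sq_nonneg (|x| - 1)]
  · refine hd.mono' (measurable_id.pow_const 2).aestronglyMeasurable (Eventually.of_forall fun x => ?_)
    rw [Real.norm_eq_abs, abs_of_nonneg (sq_nonneg x), ← sq_abs]
    have := abs_nonneg x
    nlinarith [mul_nonneg this (sq_nonneg (|x| - 1)), sq_nonneg (|x| - 1)]

theorem integral_abs_le_one (hi : Integrable (fun x : ℝ => x) Q)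
    (hi2 : Integrable (fun x : ℝ => x ^ 2) Q) (h2 : ∫ x, x ^ 2 ∂Q ≤ 1) : ∫ x, |x| ∂Q ≤ 1 := by
  calc ∫ x, |x| ∂Q ≤ ∫ x, (x ^ 2 + 1) / 2 ∂Q :=
        integral_mono hi.abs ((hi2.add (integrable_const 1)).div_const 2) fun x => by
          simp only
          nlinarith [sq_nonneg (|x| - 1), sq_abs x]
    _ = ((∫ x, x ^ 2 ∂Q) + 1) / 2 := by
        rw [integral_div, integral_add hi2 (integrable_const 1)]; simp
    _ ≤ 1 := by linarith

theorem one_le_integral_abs_cube (h3 : Integrable (fun x => |x| ^ 3) Q)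
    (h2 : ∫ x, x ^ 2 ∂Q = 1) : 1 ≤ ∫ x, |x| ^ 3 ∂Q := by
  have hi2 := (integrable_abs_pow_of_cube h3).2
  have : ∫ x, x ^ 2 ∂Q ≤ ∫ x, (2 * |x| ^ 3 + 1) / 3 ∂Q :=
    integral_mono hi2 (((h3.const_mul 2).add (integrable_const 1)).div_const 3) fun x => by
      simp only
      rw [← sq_abs]
      nlinarith [mul_nonneg (abs_nonneg x) (sq_nonneg (|x| - 1)), sq_nonneg (|x| - 1)]
  rw [h2, integral_div, integral_add (h3.const_mul 2) (integrable_const 1), integral_const_mul] at this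
  simp at this
  linarith

theorem integral_sum_pi_sq (hi : MemLp (fun x : ℝ => x) 2 Q) (h1 : ∫ x, x ∂Q = 0)
    (h2 : ∫ x, x ^ 2 ∂Q = 1) (m : ℕ) :
    Integrable (fun ω : Fin m → ℝ => ∑ j, ω j) (Measure.pi fun _ => Q) ∧
    Integrable (fun ω : Fin m → ℝ => (∑ j, ω j) ^ 2) (Measure.pi fun _ => Q) ∧
    ∫ ω : Fin m → ℝ, (∑ j, ω j) ^ 2 ∂(Measure.pi fun _ => Q) = m := by
  have hcoord : ∀ j : Fin m, MemLp (fun ω : Fin m → ℝ => ω j) 2 (Measure.pi fun _ => Q) :=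
    fun j => hi.comp_measurePreserving (measurePreserving_eval (fun _ : Fin m => Q) j)
  have hsum : MemLp (fun ω : Fin m → ℝ => ∑ j, ω j) 2 (Measure.pi fun _ => Q) :=
    memLp_finsetSum _ fun j _ => hcoord j
  have hint : ∀ j : Fin m, Integrable (fun ω : Fin m → ℝ => ω j) (Measure.pi fun _ => Q) :=
    fun j => (hcoord j).integrable (by norm_num)
  refine ⟨hsum.integrable (by norm_num), hsum.integrable_sq, ?_⟩
  have hmean : ∫ ω : Fin m → ℝ, ∑ j, ω j ∂(Measure.pi fun _ => Q) = 0 := by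
    rw [integral_finsetSum _ fun j _ => hint j]
    refine Finset.sum_eq_zero fun j _ => ?_
    rw [integral_comp_eval (μ := fun _ : Fin m => Q) (f := fun x => x)
      measurable_id.aestronglyMeasurable, h1]
  have hv := variance_sum_pi (μ := fun _ : Fin m => Q) (X := fun _ x => x) fun _ => hi
  have hv1 : Var[fun x : ℝ => x; Q] = 1 := by
    rw [variance_of_integral_eq_zero measurable_id'.aemeasurable h1]; exact h2
  have hfun : (∑ i : Fin m, fun ω : Fin m → ℝ => ω i) = fun ω => ∑ j, ω j := by
    funext ω; simp
  rw [hfun, variance_of_integral_eq_zero (by fun_prop) hmean] at hv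
  simpa [hv1] using hv

/-- The induction step for the Berry–Esseen theorem: Stein's equation for a ramp of width
`α = 8 γ` is tested on the sum of `m + 1` variables; the singular part of the derivative of its
solution is controlled by the distribution of the sum of `m` of them. -/
theorem berry_esseen_step (h1 : ∫ x, x ∂Q = 0) (h2 : ∫ x, x ^ 2 ∂Q = 1)
    (h3 : Integrable (fun x => |x| ^ 3) Q) {m : ℕ} (hm : 1 ≤ m) {δ : ℝ}
    (hδ : ∀ x, |(Measure.pi fun _ : Fin m => Q).real {ω | ∑ j, ω j ≤ √m * x} - normalCDF x| ≤ δ)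
    (x : ℝ) :
    |(Measure.pi fun _ : Fin (m + 1) => Q).real {ω | ∑ j, ω j ≤ √(m + 1 : ℕ) * x} - normalCDF x|
      ≤ 26 * ((∫ x, |x| ^ 3 ∂Q) / √(m + 1 : ℕ)) + δ / 2 := by
  obtain ⟨hi, hi2⟩ := integrable_abs_pow_of_cube h3
  have hL2 : MemLp (fun x : ℝ => x) 2 Q :=
    (memLp_two_iff_integrable_sq measurable_id.aestronglyMeasurable).2 hi2
  have hT := one_le_integral_abs_cube h3 h2
  set T := ∫ x, |x| ^ 3 ∂Q with hTdef
  have hm0 : (0 : ℝ) < m := by exact_mod_cast hm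
  set s := √(m + 1 : ℕ) with hs
  have hs2 : s ^ 2 = m + 1 := by rw [hs, Real.sq_sqrt (by positivity)]; push_cast; ring
  have hs0 : 0 < s := Real.sqrt_pos.2 (by positivity)
  have hr0 : 0 < √(m : ℝ) := Real.sqrt_pos.2 hm0
  set γ := T / s with hγ
  have hγ0 : 0 < γ := by positivity
  have hδ0 : 0 ≤ δ := (abs_nonneg _).trans (hδ 0)
  set α := 8 * γ with hα
  have hα0 : 0 < α := by positivity
  set πm := Measure.pi fun _ : Fin m => Q with hπm
  set πn := Measure.pi fun _ : Fin (m + 1) => Q with hπn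
  have hWm : Measurable fun ω : Fin m → ℝ => (∑ j, ω j) / s := by fun_prop
  have hWn : Measurable fun ω : Fin (m + 1) → ℝ => (∑ j, ω j) / s := by fun_prop
  set ν := πm.map fun ω => (∑ j, ω j) / s with hνdef
  have : IsProbabilityMeasure ν := Measure.isProbabilityMeasure_map hWm.aemeasurable
  -- concentration of the sum of `m` variables
  have hcdf : ∀ a, |ν.real (Set.Iic a) - normalCDF (s / √m * a)| ≤ δ := fun a => by
    have e : ν.real (Set.Iic a) = πm.real {ω | ∑ j, ω j ≤ √m * (s / √m * a)} := by
      rw [hνdef, map_measureReal_apply hWm measurableSet_Iic]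
      congr 1
      ext ω
      simp only [Set.mem_preimage, Set.mem_Iic, Set.mem_ofPred_eq]
      rw [div_le_iff₀ hs0, ← mul_assoc, mul_div_cancel₀ _ hr0.ne', mul_comm]
    rw [e]; exact hδ _
  have hratio : s / √m ≤ 2 := by
    rw [div_le_iff₀ hr0]
    refine abs_le_of_sq_le_sq' ?_ (by positivity) |>.2
    rw [hs2, mul_pow, Real.sq_sqrt hm0.le]
    have : (1 : ℝ) ≤ m := by exact_mod_cast hm
    linarith
  have hν : ∀ a b, a ≤ b → ν.real (Set.Ioc a b) ≤ 2 * δ + (b - a) := fun a b hab => by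
    have e : ν.real (Set.Ioc a b) = ν.real (Set.Iic b) - ν.real (Set.Iic a) := by
      rw [← Set.Iic_sdiff_Iic, measureReal_sdiff (Set.Iic_subset_Iic.2 hab) measurableSet_Iic]
    have ha := abs_le.1 (hcdf a)
    have hb := abs_le.1 (hcdf b)
    have hle := normalCDF_sub_le (mul_le_mul_of_nonneg_left hab (by positivity : 0 ≤ s / √m))
    have : s / √m * b - s / √m * a ≤ 2 * (b - a) := by
      rw [← mul_sub]; exact mul_le_mul_of_nonneg_right hratio (by linarith)
    rw [e]
    linarith
  -- moments of the sum of `m` variables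
  obtain ⟨hSi, hSi2, hS2⟩ := integral_sum_pi_sq hL2 h1 h2 m
  have hνint : ∀ {u : ℝ → ℝ}, Continuous u → ∫ w, u w ∂ν = ∫ ω, u ((∑ j, ω j) / s) ∂πm :=
    fun hu => integral_map hWm.aemeasurable hu.aestronglyMeasurable
  have hid : Integrable (fun w : ℝ => w) ν :=
    (integrable_map_measure measurable_id.aestronglyMeasurable hWm.aemeasurable).2
      (hSi.div_const s)
  have hsq : Integrable (fun w : ℝ => w ^ 2) ν :=
    (integrable_map_measure (measurable_id.pow_const 2).aestronglyMeasurable hWm.aemeasurable).2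
      (by simpa [Function.comp_def, div_pow] using hSi2.div_const (s ^ 2))
  have hsq1 : ∫ w, w ^ 2 ∂ν ≤ 1 := by
    rw [hνint (by fun_prop)]
    simp only [div_pow]
    rw [integral_div, hS2, hs2, div_le_one (by positivity)]
    linarith
  have habs := integral_abs_le_one hid hsq hsq1
  -- the comparison with the normal law for ramps in place of indicators
  have key : ∀ z, |(∫ ω, ramp z α ((∑ j, ω j) / s) ∂πn) - ∫ y, ramp z α y ∂gaussianReal 0 1|
      ≤ 18 * γ + δ / 2 := fun z => by
    obtain ⟨f, hf, hf5, hxf⟩ := exists_stein_solution (continuous_ramp z α) (ramp_nonneg z α)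
      (ramp_le_one z α)
    obtain ⟨hN0, hN1⟩ : 0 ≤ (∫ y, ramp z α y ∂gaussianReal 0 1) ∧
        (∫ y, ramp z α y ∂gaussianReal 0 1) ≤ 1 := by
      refine ⟨integral_nonneg fun y => ramp_nonneg z α y, ?_⟩
      exact (integral_ramp_bounds (gaussianReal 0 1) measurable_id z hα0).2.trans measureReal_le_one
    set N := ∫ y, ramp z α y ∂gaussianReal 0 1 with hN
    have hav := fun t => stein_solution_average hα0 hδ0 hν hid habs hN0 hN1 hf hf5 hxf t
    have hfc : Continuous f := continuous_iff_continuousAt.2 fun x => (hf x).continuousAt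
    have hrc := continuous_ramp z α
    set d : ℝ → ℝ := fun x => x * f x + (ramp z α x - N) with hd
    have hdc : Continuous d := (continuous_id.mul hfc).add (hrc.sub continuous_const)
    have hd2 : ∀ x, |d x| ≤ 2 := fun x => by
      have h1 : |ramp z α x - N| ≤ 1 := abs_le.2
        ⟨by linarith [ramp_nonneg z α x], by linarith [ramp_le_one z α x]⟩
      exact (abs_add_le _ _).trans (by linarith [hxf x])
    set g : ℝ → ℝ := fun t => ∫ w, f (w + t) ∂ν with hg
    set k : ℝ → ℝ := fun t => ∫ w, d (w + t) ∂ν with hk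
    set k0 := ∫ w, d w ∂ν with hk0
    set g0 := ∫ w, f w ∂ν with hg0
    have hshift : ∀ x : ℝ, ∀ ω : Fin m → ℝ, (x + ∑ j, ω j) / s = (∑ j, ω j) / s + x / s :=
      fun x ω => by ring
    have eg : ∀ x, g (x / s) = ∫ ω, f ((x + ∑ j, ω j) / s) ∂(Measure.pi fun _ : Fin m => Q) := fun x => by
      simp only [hg, hshift]
      exact hνint (hfc.comp (continuous_id.add continuous_const))
    have ek : ∀ x, k (x / s) = ∫ ω, d ((x + ∑ j, ω j) / s) ∂(Measure.pi fun _ : Fin m => Q) := fun x => by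
      simp only [hk, hshift]
      exact hνint (hdc.comp (continuous_id.add continuous_const))
    obtain ⟨iD, iK, eD⟩ := integral_pi_coord_sum Q (0 : Fin (m + 1))
      (F := fun _ y => d (y / s)) (c := 2) (hdc.comp (by fun_prop))
      (fun x y => (hd2 _).trans (by linarith [abs_nonneg x])) hi
    have hF := fun i => integral_pi_coord_sum Q (i : Fin (m + 1))
      (F := fun x y => x / s * f (y / s)) (c := 5 / s)
      ((by fun_prop : Continuous fun p : ℝ × ℝ => p.1 / s).mul
        (hfc.comp (by fun_prop : Continuous fun p : ℝ × ℝ => p.2 / s)))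
      (fun x y => by
        rw [abs_mul, abs_div, abs_of_pos hs0, div_mul_eq_mul_div, div_mul_eq_mul_div]
        refine div_le_div_of_nonneg_right ?_ hs0.le
        nlinarith [mul_le_mul_of_nonneg_left (hf5 (y / s)) (abs_nonneg x), abs_nonneg x]) hi
    simp only [← ek] at iK eD
    simp only [integral_const_mul, ← eg] at hF
    have iG := (hF 0).2.1
    -- the sum over the coordinates is `W f(W)`
    have hWf : ∫ ω, (∑ j, ω j) / s * f ((∑ j, ω j) / s) ∂πn
        = s ^ 2 * ∫ x, x / s * g (x / s) ∂Q := by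
      have : ∀ ω : Fin (m + 1) → ℝ, (∑ j, ω j) / s * f ((∑ j, ω j) / s)
          = ∑ i, ω i / s * f ((∑ j, ω j) / s) := fun ω => by
        rw [← Finset.sum_mul, Finset.sum_div]
      simp only [this]
      rw [integral_finsetSum _ fun i _ => (hF i).1, Finset.sum_congr rfl fun i _ => (hF i).2.2]
      simp [hs2]
    have iWf : Integrable (fun ω : Fin (m + 1) → ℝ => (∑ j, ω j) / s * f ((∑ j, ω j) / s)) πn :=
      Integrable.of_bound (hWn.mul (hfc.measurable.comp hWn)).aestronglyMeasurable 1
        (Eventually.of_forall fun ω => hxf _)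
    have iR : Integrable (fun ω : Fin (m + 1) → ℝ => ramp z α ((∑ j, ω j) / s)) πn :=
      Integrable.of_bound (hrc.measurable.comp hWn).aestronglyMeasurable 1
        (Eventually.of_forall fun x => by
          rw [Real.norm_eq_abs, abs_of_nonneg (ramp_nonneg _ _ _)]; exact ramp_le_one _ _ _)
    have e1 : (∫ ω, ramp z α ((∑ j, ω j) / s) ∂πn) - N
        = (∫ x, k (x / s) ∂Q) - s ^ 2 * ∫ x, x / s * g (x / s) ∂Q := by
      rw [← eD, ← hWf, ← integral_sub iD iWf]
      have : ∀ ω : Fin (m + 1) → ℝ, d ((∑ j, ω j) / s) - (∑ j, ω j) / s * f ((∑ j, ω j) / s)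
          = ramp z α ((∑ j, ω j) / s) - N := fun ω => by simp only [hd]; ring
      simp only [this]
      rw [integral_sub iR (integrable_const N)]
      simp
    -- the first two Taylor coefficients drop out, as the first two moments match
    have e2 : (∫ x, k (x / s) ∂Q) - s ^ 2 * ∫ x, x / s * g (x / s) ∂Q
        = ∫ x, ((k (x / s) - k0) - s ^ 2 * (x / s * (g (x / s) - g0 - x / s * k0))) ∂Q := by
      have j1 : Integrable (fun x => s * g0 * x) Q := hi.const_mul _
      have j2 : Integrable (fun x => k0 * x ^ 2) Q := hi2.const_mul _
      have j3 : Integrable (fun x => s * g0 * x + k0 * x ^ 2) Q := j1.add j2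
      have j4 : Integrable (fun x => s * g0 * x + k0 * x ^ 2 - k0) Q := j3.sub (integrable_const _)
      have j5 : Integrable (fun x => s ^ 2 * (x / s * g (x / s))) Q := iG.const_mul _
      have j6 : Integrable (fun x => k (x / s) - s ^ 2 * (x / s * g (x / s))) Q := iK.sub j5
      have hx0 : ∫ x, (s * g0 * x + k0 * x ^ 2 - k0) ∂Q = 0 := by
        rw [integral_sub j3 (integrable_const _), integral_add j1 j2, integral_const_mul,
          integral_const_mul, h1, h2]
        simp
      have : ∀ x, (k (x / s) - k0) - s ^ 2 * (x / s * (g (x / s) - g0 - x / s * k0))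
          = (k (x / s) - s ^ 2 * (x / s * g (x / s))) + (s * g0 * x + k0 * x ^ 2 - k0) :=
        fun x => by field_simp; ring
      simp only [this]
      rw [integral_add j6 j4, hx0, integral_sub iK j5, integral_const_mul, add_zero]
    have hA : 0 ≤ 2 * δ / α + 9 := by positivity
    have hbound : ∀ x, |(k (x / s) - k0) - s ^ 2 * (x / s * (g (x / s) - g0 - x / s * k0))|
        ≤ (2 * δ / α + 9) / s * (|x| + |x| ^ 3) := fun x => by
      refine (abs_sub _ _).trans ?_
      have b1 := (hav (x / s)).1
      have b2 := (hav (x / s)).2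
      rw [abs_div, abs_of_pos hs0] at b1
      have b3 : |s ^ 2 * (x / s * (g (x / s) - g0 - x / s * k0))|
          ≤ s ^ 2 * (|x| / s * ((2 * δ / α + 9) * (x / s) ^ 2)) := by
        rw [abs_mul, abs_mul, abs_div, abs_of_pos hs0, abs_of_nonneg (sq_nonneg s)]
        gcongr
      refine (add_le_add b1 b3).trans (le_of_eq ?_)
      rw [div_pow, ← sq_abs x]
      field_simp
    rw [e1, e2]
    calc _ ≤ ∫ x, (2 * δ / α + 9) / s * (|x| + |x| ^ 3) ∂Q := by
          refine abs_integral_le_integral_abs.trans ?_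
          exact integral_mono_of_nonneg (Eventually.of_forall fun _ => abs_nonneg _)
            ((hi.abs.add h3).const_mul _) (Eventually.of_forall hbound)
      _ = (2 * δ / α + 9) / s * ((∫ x, |x| ∂Q) + T) := by
          rw [integral_const_mul, integral_add hi.abs h3]
      _ ≤ (2 * δ / α + 9) / s * (T + T) := by
          gcongr
          exact (integral_abs_le_one hi hi2 h2.le).trans hT
      _ = 18 * γ + δ / 2 := by
          rw [hα, hγ]
          field_simp
          ring
  have hset : ∀ y, {ω : Fin (m + 1) → ℝ | ∑ j, ω j ≤ s * y} = {ω | (∑ j, ω j) / s ≤ y} := fun y => by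
    ext ω
    simp only [Set.mem_ofPred_eq]
    rw [div_le_iff₀ hs0, mul_comm]
  rw [hset, abs_le]
  constructor
  · have r1 := (integral_ramp_bounds πn hWn (x - α) hα0).2
    have r2 := (integral_ramp_bounds (gaussianReal 0 1) measurable_id (x - α) hα0).1
    have r3 := (abs_le.1 (key (x - α))).1
    have r4 := normalCDF_sub_le (by linarith : x - α ≤ x)
    rw [normalCDF_eq_real (x - α)] at r4
    simp only [id, sub_add_cancel] at r1 r2
    linarith
  · have r1 := (integral_ramp_bounds πn hWn x hα0).1
    have r2 := (integral_ramp_bounds (gaussianReal 0 1) measurable_id x hα0).2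
    have r3 := (abs_le.1 (key x)).2
    have r4 := normalCDF_sub_le (by linarith : x ≤ x + α)
    rw [normalCDF_eq_real (x + α)] at r4
    simp only [id] at r2
    linarith

theorem berry_esseen_standardized (h1 : ∫ x, x ∂Q = 0) (h2 : ∫ x, x ^ 2 ∂Q = 1)
    (h3 : Integrable (fun x => |x| ^ 3) Q) {n : ℕ} (hn : 1 ≤ n) :
    ∀ x, |(Measure.pi fun _ : Fin n => Q).real {ω | ∑ j, ω j ≤ √n * x} - normalCDF x|
      ≤ 100 * ((∫ x, |x| ^ 3 ∂Q) / √n) := by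
  have hT := one_le_integral_abs_cube h3 h2
  induction n, hn using Nat.le_induction with
  | base =>
    intro x
    have a1 := measureReal_nonneg (μ := Measure.pi fun _ : Fin 1 => Q)
      (s := {ω | ∑ j, ω j ≤ √(1 : ℕ) * x})
    have a2 := measureReal_le_one (μ := Measure.pi fun _ : Fin 1 => Q)
      (s := {ω | ∑ j, ω j ≤ √(1 : ℕ) * x})
    have a3 := normalCDF_pos x
    have a4 := normalCDF_lt_one x
    have a5 : √((1 : ℕ) : ℝ) = 1 := by simp
    rw [a5] at a1 a2 ⊢
    rw [abs_le, div_one]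
    constructor <;> linarith
  | succ m hm ih =>
    intro x
    refine (berry_esseen_step h1 h2 h3 hm ih x).trans ?_
    have hm1 : (1 : ℝ) ≤ m := by exact_mod_cast hm
    have hr0 : 0 < √(m : ℝ) := Real.sqrt_pos.2 (by linarith)
    have hs0 : 0 < √((m + 1 : ℕ) : ℝ) := Real.sqrt_pos.2 (by positivity)
    have hcmp : √((m + 1 : ℕ) : ℝ) ≤ 1.48 * √(m : ℝ) := by
      refine abs_le_of_sq_le_sq' ?_ (by positivity) |>.2
      rw [mul_pow, Real.sq_sqrt (by positivity), Real.sq_sqrt (by positivity)]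
      push_cast
      linarith
    -- `26 + 1.48 * 100 / 2 = 100` closes the recursion
    have hle : (∫ x, |x| ^ 3 ∂Q) / √m ≤ 1.48 * ((∫ x, |x| ^ 3 ∂Q) / √(m + 1 : ℕ)) := by
      rw [div_le_iff₀ hr0]
      have : (∫ x, |x| ^ 3 ∂Q) / √(m + 1 : ℕ) * √(m + 1 : ℕ)
          ≤ (∫ x, |x| ^ 3 ∂Q) / √(m + 1 : ℕ) * (1.48 * √m) := by gcongr
      rw [div_mul_cancel₀ _ hs0.ne'] at this
      linarith
    linarith

end Standardized

/-- The **Berry–Esseen theorem**, with a non-optimal constant. -/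
theorem isBerryEsseenBound_hundred : IsBerryEsseenBound 100 := by
  intro P _ h3 hV n hn x
  have hmem : Integrable (fun t : ℝ => t) P ∧ Integrable (fun t : ℝ => t ^ 2) P :=
    integrable_abs_pow_of_cube h3
  obtain ⟨hi, hi2⟩ := hmem
  set μ := ∫ t, t ∂P with hμ
  set v := √Var[id; P] with hv
  have hv0 : 0 < v := Real.sqrt_pos.2 hV
  have hvar : v ^ 2 = ∫ t, (t - μ) ^ 2 ∂P := by
    rw [hv, Real.sq_sqrt hV.le, variance_eq_integral measurable_id.aemeasurable]
    rfl
  set Q := P.map fun t => (t - μ) / v with hQ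
  have hmeas : Measurable fun t : ℝ => (t - μ) / v := by fun_prop
  have : IsProbabilityMeasure Q := Measure.isProbabilityMeasure_map hmeas.aemeasurable
  have hint : ∀ {u : ℝ → ℝ}, Continuous u → ∫ t, u t ∂Q = ∫ t, u ((t - μ) / v) ∂P :=
    fun hu => integral_map hmeas.aemeasurable hu.aestronglyMeasurable
  have q1 : ∫ t, t ∂Q = 0 := by
    rw [hint continuous_id', integral_div, integral_sub hi (integrable_const _)]
    simp [hμ]
  have q2 : ∫ t, t ^ 2 ∂Q = 1 := by
    rw [hint (by fun_prop)]
    simp only [div_pow]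
    rw [integral_div, ← hvar, div_self (by positivity)]
  have q3 : Integrable (fun t => |t| ^ 3) Q := by
    rw [hQ, integrable_map_measure (by fun_prop) hmeas.aemeasurable]
    have hd : Integrable (fun t : ℝ => 4 * (|t| ^ 3 + |μ| ^ 3) / v ^ 3) P :=
      ((h3.add (integrable_const _)).const_mul 4).div_const _
    refine hd.mono' (by fun_prop) (Eventually.of_forall fun t => ?_)
    simp only [Function.comp]
    rw [Real.norm_eq_abs, abs_pow, abs_abs, abs_div, abs_of_pos hv0, div_pow]
    gcongr
    have h1 : |t - μ| ^ 3 ≤ (|t| + |μ|) ^ 3 := by gcongr; exact abs_sub _ _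
    nlinarith [mul_nonneg (add_nonneg (abs_nonneg t) (abs_nonneg μ)) (sq_nonneg (|t| - |μ|))]
  have hT : ∫ t, |t| ^ 3 ∂Q = (∫ t, |t - μ| ^ 3 ∂P) / v ^ 3 := by
    rw [hint (by fun_prop), ← integral_div]
    simp only [abs_div, abs_of_pos hv0, div_pow]
  have hb := berry_esseen_standardized q1 q2 q3 hn (x / v)
  have hpi : (Measure.pi fun _ : Fin n => P).map (fun ω i => (ω i - μ) / v)
      = Measure.pi fun _ : Fin n => Q := by
    have : ∀ _ : Fin n, SigmaFinite (P.map fun t => (t - μ) / v) := fun _ => by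
      rw [← hQ]; infer_instance
    exact Measure.pi_map_pi (μ := fun _ : Fin n => P) (f := fun _ t => (t - μ) / v)
      fun _ => hmeas.aemeasurable
  have hn0 : (0 : ℝ) < n := by exact_mod_cast hn
  have hs0 : 0 < √(n : ℝ) := Real.sqrt_pos.2 hn0
  rw [← hpi, map_measureReal_apply (by fun_prop) (measurableSet_le (by fun_prop) (by fun_prop)),
    hT] at hb
  have hset : (fun (ω : Fin n → ℝ) i => (ω i - μ) / v) ⁻¹' {ω | ∑ j, ω j ≤ √n * (x / v)}
      = {ω | √n * (1 / (n : ℝ) * ∑ i, ω i - μ) ≤ x} := by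
    ext ω
    simp only [Set.mem_preimage, Set.mem_ofPred_eq]
    rw [← Finset.sum_div, Finset.sum_sub_distrib, ← mul_div_assoc, div_le_div_iff_of_pos_right hv0]
    have hsq : √(n : ℝ) * √(n : ℝ) = n := Real.mul_self_sqrt hn0.le
    have e : √(n : ℝ) * (1 / (n : ℝ) * ∑ i, ω i - μ) * √(n : ℝ) = ∑ i, ω i - n * μ := by
      rw [mul_right_comm, hsq]; field_simp
    simp only [Finset.sum_const, Finset.card_univ, Fintype.card_fin, nsmul_eq_mul]
    rw [← e, mul_comm (√(n : ℝ)) x, mul_le_mul_iff_left₀ hs0]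
  rw [hset] at hb
  refine hb.trans (le_of_eq ?_)
  field_simp

/-- The infimum defining the Berry–Esseen constant is attained: for a fixed law, admissibility is a
closed condition on the constant. -/
theorem isBerryEsseenBound_berryEsseenConstant : IsBerryEsseenBound berryEsseenConstant := by
  intro P _ h3 hV n hn x
  have hs0 : 0 < √(n : ℝ) := Real.sqrt_pos.2 (by exact_mod_cast hn)
  have hden : 0 < √n * √(Var[id; P]) ^ 3 := by
    have := Real.sqrt_pos.2 hV
    positivity
  rcases (integral_nonneg fun t => by positivity :
    0 ≤ ∫ t, |t - ∫ s, s ∂P| ^ 3 ∂P).eq_or_lt with h0 | h0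
  · have := isBerryEsseenBound_hundred P h3 hV n hn x
    rw [← h0] at this ⊢
    simpa using this
  · rw [le_div_iff₀ hden, ← div_le_iff₀ h0]
    refine le_csInf ⟨100, isBerryEsseenBound_hundred⟩ fun C hC => ?_
    have := hC P h3 hV n hn x
    rwa [le_div_iff₀ hden, ← div_le_iff₀ h0] at this

/-! ### One-shot bounds for hypothesis testing -/

open Matrix in
theorem _root_.Matrix.PosSemidef.exists_eq_conjTranspose_mul_self {κ : Type*} [Fintype κ]
    [DecidableEq κ] {B : Matrix κ κ ℂ} (hB : B.PosSemidef) : ∃ K : Matrix κ κ ℂ, B = Kᴴ * K := by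
  open scoped MatrixOrder Matrix.Norms.L2Operator in
  exact CStarAlgebra.nonneg_iff_eq_star_mul_self.1 (Matrix.nonneg_iff_posSemidef.2 hB)

section OneShot

open Matrix

variable {κ : Type*} [Fintype κ]

/-- The squared Euclidean norm of a vector. -/
def nsq (v : κ → ℂ) : ℝ := ∑ y, ‖v y‖ ^ 2

theorem nsq_nonneg (v : κ → ℂ) : 0 ≤ nsq v := Finset.sum_nonneg fun _ _ => by positivity

theorem star_dotProduct_self (v : κ → ℂ) : star v ⬝ᵥ v = (nsq v : ℂ) := by
  simp only [dotProduct, nsq, Complex.ofReal_sum, Complex.ofReal_pow, Pi.star_apply,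
    RCLike.star_def, Complex.conj_mul']

theorem nsq_eq_zero {v : κ → ℂ} (h : nsq v = 0) : v = 0 := by
  have := star_dotProduct_self v
  rw [h, Complex.ofReal_zero] at this
  exact dotProduct_star_self_eq_zero.1 this

theorem dotProduct_conjTranspose_mul_self_mulVec (K : Matrix κ κ ℂ) (v : κ → ℂ) :
    star v ⬝ᵥ (Kᴴ * K) *ᵥ v = (nsq (K *ᵥ v) : ℂ) := by
  rw [← star_dotProduct_self, star_mulVec, ← mulVec_mulVec, ← dotProduct_mulVec]

theorem nsq_add_le (u v : κ → ℂ) {t : ℝ} (ht : 0 < t) :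
    nsq (u + v) ≤ (1 + 1 / t) * nsq u + (1 + t) * nsq v := by
  rw [nsq, nsq, nsq, Finset.mul_sum, Finset.mul_sum, ← Finset.sum_add_distrib]
  refine Finset.sum_le_sum fun y _ => ?_
  have h1 : ‖(u + v) y‖ ^ 2 ≤ (‖u y‖ + ‖v y‖) ^ 2 := by
    gcongr; exact norm_add_le _ _
  have h2 : 0 ≤ (‖u y‖ - t * ‖v y‖) ^ 2 / t := by positivity
  have h3 : (‖u y‖ - t * ‖v y‖) ^ 2 / t
      = 1 / t * ‖u y‖ ^ 2 - 2 * (‖u y‖ * ‖v y‖) + t * ‖v y‖ ^ 2 := by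
    field_simp; ring
  rw [h3] at h2
  nlinarith

theorem sq_norm_dotProduct_le (u v : κ → ℂ) : ‖star u ⬝ᵥ v‖ ^ 2 ≤ nsq u * nsq v := by
  have h1 : ‖star u ⬝ᵥ v‖ ≤ ∑ y, ‖u y‖ * ‖v y‖ := by
    refine (norm_sum_le _ _).trans (le_of_eq (Finset.sum_congr rfl fun y _ => ?_))
    rw [norm_mul, Pi.star_apply, norm_star]
  calc _ ≤ (∑ y, ‖u y‖ * ‖v y‖) ^ 2 := by gcongr
    _ ≤ _ := Finset.sum_mul_sq_le_sq_mul_sq _ _ _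

/-- Multiplication by a unitary matrix preserves the Euclidean norms of the rows. -/
theorem sum_norm_sq_mul_unitary [DecidableEq κ] {M : Matrix κ κ ℂ} (hM : M * Mᴴ = 1)
    (N : Matrix κ κ ℂ) (z : κ) : ∑ x, ‖(N * M) z x‖ ^ 2 = ∑ y, ‖N z y‖ ^ 2 := by
  have key : ∀ N : Matrix κ κ ℂ, ((∑ y, ‖N z y‖ ^ 2 : ℝ) : ℂ) = (N * Nᴴ) z z := fun N => by
    simp only [mul_apply, conjTranspose_apply, RCLike.star_def, Complex.mul_conj', Complex.ofReal_sum,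
      Complex.ofReal_pow]
  apply Complex.ofReal_injective
  rw [key, key, conjTranspose_mul, Matrix.mul_assoc, ← Matrix.mul_assoc M, hM, Matrix.one_mul]

theorem sum_two_zpow_le (S : Finset ℤ) :
    ∀ K : ℤ, (∀ k ∈ S, k ≤ K) → ∑ k ∈ S, (2 : ℝ) ^ k ≤ 2 ^ (K + 1) := by
  induction S using Finset.induction_on_max with
  | empty => intro K _; simp; positivity
  | insert a s has ih =>
    intro K hK
    have ha : a ∉ s := fun h => lt_irrefl _ (has a h)
    rw [Finset.sum_insert ha]
    have h1 := ih (a - 1) fun k hk => by have := has k hk; omega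
    rw [sub_add_cancel] at h1
    calc (2 : ℝ) ^ a + ∑ k ∈ s, 2 ^ k ≤ 2 ^ a + 2 ^ a := by gcongr
      _ = 2 ^ (a + 1) := by rw [zpow_add_one₀ two_ne_zero]; ring
      _ ≤ 2 ^ (K + 1) := by
        have := hK a (Finset.mem_insert_self _ _)
        gcongr
        norm_num

variable [DecidableEq κ]

theorem isTest_of_isProj {B : Matrix κ κ ℂ} (hH : Bᴴ = B) (hB : B * B = B) : IsTest B := by
  constructor
  · have := posSemidef_conjTranspose_mul_self B
    rwa [hH, hB] at this
  · have := posSemidef_conjTranspose_mul_self (1 - B)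
    have e : (1 - B)ᴴ * (1 - B) = 1 - B := by
      rw [conjTranspose_sub, hH, conjTranspose_one, Matrix.sub_mul, Matrix.mul_sub, Matrix.mul_sub, hB]
      simp
    rwa [e] at this

/-- A projection whose range contains prescribed vectors `ξ x`, obtained by orthogonalizing them in
the order of increasing `lam x`. If `ξ x` is supported where `L μ(y) ≤ lam x`, then so is its
orthogonalization, and its contribution to the error of the second kind is at most `lam x / L`. -/
theorem exists_projection (lam mu : κ → ℝ) (hlam : ∀ x, 0 ≤ lam x) {L : ℝ} (hL : 0 < L)
    (ξ : κ → κ → ℂ) (hξ : ∀ x y, ξ x y ≠ 0 → L * mu y ≤ lam x) (S : Finset κ) :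
    ∃ B : Matrix κ κ ℂ, Bᴴ = B ∧ B * B = B ∧ (∀ x ∈ S, B *ᵥ ξ x = ξ x) ∧
      (∀ y z, B y z ≠ 0 → ∃ x ∈ S, L * mu y ≤ lam x) ∧
      ∑ y, mu y * (B y y).re ≤ (∑ x ∈ S, lam x) / L := by
  induction S using Finset.induction_on_max_value lam with
  | empty => exact ⟨0, by simp, by simp, by simp, by simp, by simp⟩
  | insert a s ha hmax ih =>
    obtain ⟨B, hH, hB, hfix, hsup, htr⟩ := ih
    set r := ξ a - B *ᵥ ξ a with hr
    have hrsup : ∀ y, r y ≠ 0 → L * mu y ≤ lam a := fun y hy => by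
      by_cases h : ξ a y = 0
      · have h2 : (B *ᵥ ξ a) y ≠ 0 := fun h2 => hy (by simp [hr, h, h2])
        obtain ⟨z, -, hz⟩ := Finset.exists_ne_zero_of_sum_ne_zero h2
        obtain ⟨x, hx, hxy⟩ := hsup y z (left_ne_zero_of_mul hz)
        exact hxy.trans (hmax x hx)
      · exact hξ a y h
    have hsum : (∑ x ∈ s, lam x) / L ≤ (∑ x ∈ insert a s, lam x) / L := by
      rw [Finset.sum_insert ha]
      gcongr
      linarith [hlam a]
    by_cases h0 : nsq r = 0
    · refine ⟨B, hH, hB, fun x hx => ?_, fun y z h => ?_, htr.trans hsum⟩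
      · rcases Finset.mem_insert.1 hx with rfl | hx
        · have := nsq_eq_zero h0
          rw [hr, sub_eq_zero] at this
          exact this.symm
        · exact hfix x hx
      · obtain ⟨x, hx, hxy⟩ := hsup y z h
        exact ⟨x, Finset.mem_insert_of_mem hx, hxy⟩
    · have hc : (nsq r : ℂ) ≠ 0 := Complex.ofReal_ne_zero.2 h0
      have hpos : 0 < nsq r := lt_of_le_of_ne (nsq_nonneg r) (Ne.symm h0)
      set c : ℂ := (nsq r : ℂ)⁻¹ with hcdef
      have hBr : B *ᵥ r = 0 := by
        rw [hr, mulVec_sub, mulVec_mulVec, hB, sub_self]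
      have hrB : star r ᵥ* B = 0 := by
        have := star_mulVec B r
        rw [hBr, hH, star_zero] at this
        exact this.symm
      set R := vecMulVec r (star r) with hR
      have hRH : Rᴴ = R := by rw [hR, conjTranspose_vecMulVec, star_star]
      have hRR : R * R = (nsq r : ℂ) • R := by
        rw [hR, vecMulVec_mul_vecMulVec, star_dotProduct_self, vecMulVec_smul]
      have hBR : B * R = 0 := by rw [hR, mul_vecMulVec, hBr, zero_vecMulVec]
      have hRB : R * B = 0 := by rw [hR, vecMulVec_mul, hrB, vecMulVec_zero]
      have hcstar : star c = c := by simp [hcdef]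
      refine ⟨B + c • R, ?_, ?_, ?_, ?_, ?_⟩
      · rw [conjTranspose_add, conjTranspose_smul, hH, hRH, hcstar]
      · rw [Matrix.add_mul, Matrix.mul_add, Matrix.mul_add, hB, Matrix.mul_smul, hBR,
          Matrix.smul_mul, hRB, Matrix.smul_mul, Matrix.mul_smul, hRR, smul_smul, smul_smul, hcdef,
          mul_assoc, inv_mul_cancel₀ hc]
        simp
      · have hRv : ∀ v, R *ᵥ v = (star r ⬝ᵥ v) • r := fun v => by
          rw [hR, vecMulVec_mulVec, op_smul_eq_smul]
        have hrBv : ∀ v, star r ⬝ᵥ B *ᵥ v = 0 := fun v => by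
          rw [dotProduct_mulVec, hrB, zero_dotProduct]
        intro x hx
        rw [add_mulVec, smul_mulVec, hRv]
        rcases Finset.mem_insert.1 hx with rfl | hx
        · have h1 : ξ x = r + B *ᵥ ξ x := by rw [hr]; abel
          have h2 : star r ⬝ᵥ ξ x = (nsq r : ℂ) := by
            rw [h1, dotProduct_add, hrBv, add_zero, star_dotProduct_self]
          rw [h2, smul_smul, hcdef, inv_mul_cancel₀ hc, one_smul, hr]
          abel
        · rw [← hfix x hx, hrBv, zero_smul, smul_zero, add_zero, mulVec_mulVec, hB]
      · intro y z h
        by_cases hBy : B y z = 0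
        · refine ⟨a, Finset.mem_insert_self _ _, hrsup y fun hy => h ?_⟩
          simp [hR, vecMulVec_apply, hBy, hy]
        · obtain ⟨x, hx, hxy⟩ := hsup y z hBy
          exact ⟨x, Finset.mem_insert_of_mem hx, hxy⟩
      · have hentry : ∀ y, ((B + c • R) y y).re = (B y y).re + ‖r y‖ ^ 2 / nsq r := fun y => by
          have : (c • R) y y = ((‖r y‖ ^ 2 / nsq r : ℝ) : ℂ) := by
            simp only [Matrix.smul_apply, hR, vecMulVec_apply, Pi.star_apply, RCLike.star_def,
              Complex.mul_conj', smul_eq_mul, hcdef]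
            push_cast
            field_simp
          rw [Matrix.add_apply, this, Complex.add_re, Complex.ofReal_re]
        simp only [hentry, mul_add, Finset.sum_add_distrib]
        rw [Finset.sum_insert ha, add_div, add_comm]
        refine add_le_add ?_ htr
        calc ∑ y, mu y * (‖r y‖ ^ 2 / nsq r) ≤ ∑ y, lam a / L * (‖r y‖ ^ 2 / nsq r) := by
              refine Finset.sum_le_sum fun y _ => ?_
              by_cases hy : r y = 0
              · simp [hy]
              · have : mu y ≤ lam a / L := by rw [le_div_iff₀ hL, mul_comm]; exact hrsup y hy
                gcongr
          _ = lam a / L := by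
              rw [← Finset.mul_sum, ← Finset.sum_div]
              change lam a / L * (nsq r / nsq r) = _
              rw [div_self h0, mul_one]

theorem trace_diagonal_mul_re (mu : κ → ℝ) (B : Matrix κ κ ℂ) :
    (diagonal (fun y => (mu y : ℂ)) * B).trace.re = ∑ y, mu y * (B y y).re := by
  simp [trace, diagonal_mul]

theorem trace_conj_diagonal_mul_re (lam : κ → ℝ) (M B : Matrix κ κ ℂ) :
    (M * diagonal (fun x => (lam x : ℂ)) * Mᴴ * B).trace.re
      = ∑ x, lam x * (star (fun y => M y x) ⬝ᵥ B *ᵥ fun y => M y x).re := by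
  rw [Matrix.mul_assoc, Matrix.trace_mul_comm, ← Matrix.mul_assoc, Matrix.trace_mul_comm,
    trace_diagonal_mul_re]
  refine Finset.sum_congr rfl fun x _ => ?_
  rw [Matrix.mul_assoc]
  rfl

/-- The direct part: for every threshold `L`, a test that is as powerful as the likelihood ratio test
`lam x ≥ L * mu y` for the joint distribution `lam x * ‖M y x‖ ^ 2`. -/
theorem exists_test (lam mu : κ → ℝ) (hlam : ∀ x, 0 ≤ lam x) (M : Matrix κ κ ℂ) {L : ℝ}
    (hL : 0 < L) :
    ∃ B : Matrix κ κ ℂ, IsTest B ∧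
      (diagonal (fun y => (mu y : ℂ)) * B).trace.re ≤ (∑ x, lam x) / L ∧
      ∑ x, ∑ y, (if L * mu y ≤ lam x then lam x * ‖M y x‖ ^ 2 else 0)
        ≤ (M * diagonal (fun x => (lam x : ℂ)) * Mᴴ * B).trace.re := by
  set ξ : κ → κ → ℂ := fun x y => if L * mu y ≤ lam x then M y x else 0 with hξ
  obtain ⟨B, hH, hB, hfix, -, htr⟩ := exists_projection lam mu hlam hL ξ
    (fun x y h => by by_contra h2; exact h (if_neg h2)) Finset.univ
  refine ⟨B, isTest_of_isProj hH hB, by rwa [trace_diagonal_mul_re], ?_⟩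
  rw [trace_conj_diagonal_mul_re]
  refine Finset.sum_le_sum fun x _ => ?_
  set m : κ → ℂ := fun y => M y x with hm
  have e1 : ∑ y, (if L * mu y ≤ lam x then lam x * ‖M y x‖ ^ 2 else 0) = lam x * nsq (ξ x) := by
    rw [nsq, Finset.mul_sum]
    refine Finset.sum_congr rfl fun y _ => ?_
    simp only [hξ]
    split_ifs <;> simp
  have e2 : (star m ⬝ᵥ B *ᵥ m).re = nsq (B *ᵥ m) := by
    have := dotProduct_conjTranspose_mul_self_mulVec B m
    rw [hH, hB] at this
    rw [this, Complex.ofReal_re]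
  rw [e1, e2]
  refine mul_le_mul_of_nonneg_left ?_ (hlam x)
  have e3 : star (ξ x) ⬝ᵥ B *ᵥ m = (nsq (ξ x) : ℂ) := by
    have h1 : star (ξ x) ᵥ* B = star (ξ x) := by
      have := star_mulVec B (ξ x)
      rw [hfix x (Finset.mem_univ x), hH] at this
      exact this.symm
    rw [dotProduct_mulVec, h1, ← star_dotProduct_self]
    refine Finset.sum_congr rfl fun y _ => ?_
    simp only [Pi.star_apply, hξ, hm]
    split_ifs <;> simp
  have cs := sq_norm_dotProduct_le (ξ x) (B *ᵥ m)
  rw [e3, Complex.norm_real, Real.norm_eq_abs, sq_abs] at cs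
  rcases (nsq_nonneg (ξ x)).eq_or_lt with h | h
  · rw [← h]; exact nsq_nonneg _
  · rw [pow_two] at cs; exact le_of_mul_le_mul_left cs h

/-- The part of the eigenvectors of the first state on which the likelihood ratio is below `L`
contributes at most `4 L β` to the power of a test with error of the second kind `β`. The
eigenvalues are sorted into dyadic classes; within a class the projections agree, so that unitarity
applies, and the classes are summed as a geometric series. -/
theorem sum_truncated_le {lam mu : κ → ℝ} (hlam : ∀ x, 0 ≤ lam x) (hmu : ∀ y, 0 ≤ mu y)
    {M : Matrix κ κ ℂ} (hM : M * Mᴴ = 1) (K : Matrix κ κ ℂ) {L : ℝ} (hL : 0 ≤ L) :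
    ∑ x, lam x * nsq (K *ᵥ fun y => if (2 : ℝ) ^ Int.log 2 (lam x) ≤ L * mu y then M y x else 0)
      ≤ 4 * L * ∑ y, mu y * ∑ z, ‖K z y‖ ^ 2 := by
  set P := Finset.univ.filter fun x => 0 < lam x with hP
  set I := P.image fun x => Int.log 2 (lam x) with hI
  set D : ℤ → Matrix κ κ ℂ := fun k => diagonal fun y => if (2 : ℝ) ^ k ≤ L * mu y then 1 else 0
    with hD
  have hu : ∀ k x, (K *ᵥ fun y => if (2 : ℝ) ^ k ≤ L * mu y then M y x else 0)
      = fun z => (K * D k * M) z x := fun k x => by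
    funext z
    rw [Matrix.mul_assoc]
    simp only [mulVec, dotProduct, mul_apply (M := K), hD, diagonal_mul]
    refine Finset.sum_congr rfl fun y _ => ?_
    split_ifs <;> simp
  have hKD : ∀ k, ∑ x, nsq (fun z => (K * D k * M) z x)
      = ∑ y, if (2 : ℝ) ^ k ≤ L * mu y then ∑ z, ‖K z y‖ ^ 2 else 0 := fun k => by
    simp only [nsq]
    rw [Finset.sum_comm]
    simp only [sum_norm_sq_mul_unitary hM]
    rw [Finset.sum_comm]
    refine Finset.sum_congr rfl fun y _ => ?_
    simp only [hD, mul_diagonal]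
    split_ifs <;> simp
  calc ∑ x, lam x * nsq (K *ᵥ fun y => if (2 : ℝ) ^ Int.log 2 (lam x) ≤ L * mu y then M y x else 0)
      = ∑ x ∈ P, lam x * nsq (fun z => (K * D (Int.log 2 (lam x)) * M) z x) := by
        simp only [hu]
        refine (Finset.sum_subset (Finset.subset_univ P) fun x _ hx => ?_).symm
        have : lam x = 0 := le_antisymm (by simpa [hP] using hx) (hlam x)
        rw [this, zero_mul]
    _ ≤ ∑ x ∈ P, 2 ^ (Int.log 2 (lam x) + 1) * nsq (fun z => (K * D (Int.log 2 (lam x)) * M) z x) := by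
        refine Finset.sum_le_sum fun x _ => mul_le_mul_of_nonneg_right ?_ (nsq_nonneg _)
        have := Int.lt_zpow_succ_log_self (b := 2) one_lt_two (lam x)
        exact_mod_cast this.le
    _ = ∑ k ∈ I, ∑ x ∈ P with Int.log 2 (lam x) = k,
          2 ^ (Int.log 2 (lam x) + 1) * nsq (fun z => (K * D (Int.log 2 (lam x)) * M) z x) :=
        (Finset.sum_fiberwise_of_maps_to (fun x hx => Finset.mem_image_of_mem _ hx) _).symm
    _ ≤ ∑ k ∈ I, 2 ^ (k + 1) * ∑ y, if (2 : ℝ) ^ k ≤ L * mu y then ∑ z, ‖K z y‖ ^ 2 else 0 := by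
        refine Finset.sum_le_sum fun k _ => ?_
        rw [← hKD, Finset.mul_sum]
        refine le_trans (le_of_eq (Finset.sum_congr rfl fun x hx => ?_))
          (Finset.sum_le_sum_of_subset_of_nonneg (Finset.subset_univ _)
            fun x _ _ => mul_nonneg (by positivity) (nsq_nonneg _))
        rw [(Finset.mem_filter.1 hx).2]
    _ = ∑ y, (∑ k ∈ I with (2 : ℝ) ^ k ≤ L * mu y, 2 ^ k) * (2 * ∑ z, ‖K z y‖ ^ 2) := by
        rw [Finset.sum_congr rfl fun k _ => Finset.mul_sum _ _ _, Finset.sum_comm]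
        refine Finset.sum_congr rfl fun y _ => ?_
        rw [Finset.sum_filter, Finset.sum_mul]
        refine Finset.sum_congr rfl fun k _ => ?_
        split_ifs
        · rw [zpow_add_one₀ two_ne_zero]; ring
        · simp
    _ ≤ ∑ y, (2 * (L * mu y)) * (2 * ∑ z, ‖K z y‖ ^ 2) := by
        refine Finset.sum_le_sum fun y _ => mul_le_mul_of_nonneg_right ?_ (by positivity)
        rcases (mul_nonneg hL (hmu y)).eq_or_lt with h | h
        · rw [← h, mul_zero]
          refine le_of_eq (Finset.sum_eq_zero fun k hk => ?_)
          exact absurd (Finset.mem_filter.1 hk).2 (not_le.2 (by positivity))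
        · have h1 := sum_two_zpow_le (I.filter fun k => (2 : ℝ) ^ k ≤ L * mu y)
            (Int.log 2 (L * mu y)) fun k hk =>
              (Int.zpow_le_iff_le_log one_lt_two h).1 (by exact_mod_cast (Finset.mem_filter.1 hk).2)
          have h2 : (2 : ℝ) ^ Int.log 2 (L * mu y) ≤ L * mu y := by
            exact_mod_cast Int.zpow_log_le_self (b := 2) one_lt_two h
          rw [zpow_add_one₀ two_ne_zero] at h1
          linarith
    _ = 4 * L * ∑ y, mu y * ∑ z, ‖K z y‖ ^ 2 := by
        rw [Finset.mul_sum]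
        exact Finset.sum_congr rfl fun y _ => by ring

/-- The converse part: the power of a test exceeds that of the likelihood ratio test at threshold
`L` by little more than `L` times its error of the second kind. -/
theorem test_power_le {lam mu : κ → ℝ} (hlam : ∀ x, 0 ≤ lam x) (hmu : ∀ y, 0 ≤ mu y)
    {M : Matrix κ κ ℂ} (hM : M * Mᴴ = 1) {B : Matrix κ κ ℂ} (hB : IsTest B) {L t : ℝ} (hL : 0 ≤ L)
    (ht : 0 < t) :
    (M * diagonal (fun x => (lam x : ℂ)) * Mᴴ * B).trace.re
      ≤ (1 + t) * ∑ x, ∑ y, (if L * mu y < lam x then lam x * ‖M y x‖ ^ 2 else 0)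
        + (1 + 1 / t) * (4 * L * (diagonal (fun y => (mu y : ℂ)) * B).trace.re) := by
  obtain ⟨K, hK⟩ := hB.1.exists_eq_conjTranspose_mul_self
  have hcontr : ∀ v, nsq (K *ᵥ v) ≤ nsq v := fun v => by
    have := hB.2.re_dotProduct_nonneg v
    rw [sub_mulVec, one_mulVec, dotProduct_sub, star_dotProduct_self, hK,
      dotProduct_conjTranspose_mul_self_mulVec] at this
    simpa using this
  have hdiag : ∀ y, (B y y).re = ∑ z, ‖K z y‖ ^ 2 := fun y => by
    rw [hK, mul_apply]
    simp only [conjTranspose_apply, RCLike.star_def, Complex.conj_mul', Complex.re_sum,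
      ← Complex.ofReal_pow, Complex.ofReal_re]
  have htrunc := sum_truncated_le hlam hmu hM K hL
  rw [trace_conj_diagonal_mul_re, trace_diagonal_mul_re]
  simp only [hdiag]
  calc ∑ x, lam x * (star (fun y => M y x) ⬝ᵥ B *ᵥ fun y => M y x).re
      ≤ ∑ x, ((1 + 1 / t) * (lam x * nsq (K *ᵥ fun y =>
            if (2 : ℝ) ^ Int.log 2 (lam x) ≤ L * mu y then M y x else 0))
          + (1 + t) * ∑ y, (if L * mu y < lam x then lam x * ‖M y x‖ ^ 2 else 0)) := by
        refine Finset.sum_le_sum fun x _ => ?_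
        set u : κ → ℂ := fun y => if (2 : ℝ) ^ Int.log 2 (lam x) ≤ L * mu y then M y x else 0 with hu
        set v : κ → ℂ := fun y => if (2 : ℝ) ^ Int.log 2 (lam x) ≤ L * mu y then 0 else M y x with hv
        have huv : (fun y => M y x) = u + v := by
          funext y; simp only [hu, hv, Pi.add_apply]; split_ifs <;> simp
        rw [hK, dotProduct_conjTranspose_mul_self_mulVec, Complex.ofReal_re, huv, mulVec_add]
        have h1 := (nsq_add_le (K *ᵥ u) (K *ᵥ v) ht).trans
          (add_le_add_right (mul_le_mul_of_nonneg_left (hcontr v) (by positivity : 0 ≤ 1 + t)) _)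
        refine (mul_le_mul_of_nonneg_left h1 (hlam x)).trans ?_
        rw [mul_add, mul_left_comm, mul_left_comm (lam x) (1 + t)]
        refine add_le_add_right (mul_le_mul_of_nonneg_left ?_ (by positivity)) _
        rw [nsq, Finset.mul_sum]
        refine Finset.sum_le_sum fun y _ => ?_
        rcases (hlam x).eq_or_lt with h0 | h0
        · simp [← h0]
        · have hlog : (2 : ℝ) ^ Int.log 2 (lam x) ≤ lam x := by
            exact_mod_cast Int.zpow_log_le_self (b := 2) one_lt_two h0
          simp only [hv]
          by_cases h : (2 : ℝ) ^ Int.log 2 (lam x) ≤ L * mu y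
          · rw [if_pos h]
            split_ifs
            · simp; positivity
            · simp
          · rw [if_neg h, if_pos ((not_le.1 h).trans_le hlog)]
    _ ≤ _ := by
        rw [Finset.sum_add_distrib, ← Finset.mul_sum, ← Finset.mul_sum, add_comm]
        refine add_le_add_right (mul_le_mul_of_nonneg_left htrunc (by positivity)) _

end OneShot

/-! ### The Berry–Esseen theorem for finitely supported laws -/

/-- The Berry–Esseen bound for `n` independent draws from a probability vector `p`. -/
theorem abs_sum_prod_sub_normalCDF_le {κ : Type*} [Fintype κ] {p : κ → ℝ} (hp : ∀ k, 0 ≤ p k)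
    (hp1 : ∑ k, p k = 1) (l : κ → ℝ) {m v T : ℝ} (hm : m = ∑ k, p k * l k)
    (hv : v = ∑ k, p k * l k ^ 2 - m ^ 2) (hv0 : 0 < v) (hT : T = ∑ k, p k * |l k - m| ^ 3)
    {n : ℕ} (hn : 1 ≤ n) (z : ℝ) :
    |(∑ ω : Fin n → κ, if ∑ i, l (ω i) ≤ n * m + √n * √v * z then ∏ i, p (ω i) else 0)
      - normalCDF z| ≤ berryEsseenConstant * T / (√n * √v ^ 3) := by
  let _ : MeasurableSpace κ := ⊤
  have : DiscreteMeasurableSpace κ := ⟨fun _ => trivial⟩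
  set ν : Measure κ := ∑ k, ENNReal.ofReal (p k) • Measure.dirac k with hν
  have hsing : ∀ k, ν {k} = ENNReal.ofReal (p k) := fun k => by
    classical
    simp [hν, Set.indicator_apply]
  have : IsProbabilityMeasure ν := ⟨by
    rw [hν]
    simp only [Measure.coe_finsetSum, Finset.sum_apply, Measure.smul_apply, measure_univ, smul_eq_mul,
      mul_one]
    rw [← ENNReal.ofReal_sum_of_nonneg fun k _ => hp k, hp1, ENNReal.ofReal_one]⟩
  have hint : ∀ u : κ → ℝ, ∫ k, u k ∂ν = ∑ k, p k * u k := fun u => by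
    rw [integral_fintype .of_finite]
    refine Finset.sum_congr rfl fun k _ => ?_
    rw [measureReal_def, hsing, ENNReal.toReal_ofReal (hp k), smul_eq_mul]
  have hl : Measurable l := measurable_of_finite l
  set P := ν.map l with hP
  have : IsProbabilityMeasure P := Measure.isProbabilityMeasure_map hl.aemeasurable
  have hintP : ∀ {u : ℝ → ℝ}, Continuous u → ∫ t, u t ∂P = ∑ k, p k * u (l k) := fun hu => by
    rw [hP, integral_map hl.aemeasurable hu.aestronglyMeasurable, hint]
  have hmean : ∫ t, t ∂P = m := by rw [hintP continuous_id', hm]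
  have hvar : Var[id; P] = v := by
    rw [variance_eq_integral measurable_id.aemeasurable]
    simp only [id]
    rw [hmean, hintP (by fun_prop), hv]
    have : ∀ k, p k * (l k - m) ^ 2 = p k * l k ^ 2 - 2 * m * (p k * l k) + m ^ 2 * p k :=
      fun k => by ring
    simp only [this, Finset.sum_add_distrib, Finset.sum_sub_distrib, ← Finset.mul_sum, hp1, ← hm]
    ring
  have h3 : Integrable (fun t => |t| ^ 3) P := by
    rw [hP, integrable_map_measure (by fun_prop) hl.aemeasurable]
    exact .of_finite
  have hbe := isBerryEsseenBound_berryEsseenConstant P h3 (by rw [hvar]; exact hv0) n hn (√v * z)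
  have hsv : 0 < √v := Real.sqrt_pos.2 hv0
  rw [hvar, hmean, hintP (by fun_prop), ← hT, mul_div_cancel_left₀ _ hsv.ne'] at hbe
  have hpi : (Measure.pi fun _ : Fin n => ν).map (fun ω i => l (ω i)) = Measure.pi fun _ => P := by
    have : ∀ _ : Fin n, SigmaFinite (ν.map l) := fun _ => by rw [← hP]; infer_instance
    exact Measure.pi_map_pi (μ := fun _ : Fin n => ν) (f := fun _ => l) fun _ => hl.aemeasurable
  have hn0 : (0 : ℝ) < n := by exact_mod_cast hn
  have hs0 : 0 < √(n : ℝ) := Real.sqrt_pos.2 hn0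
  have hfl : Measurable fun (ω : Fin n → κ) i => l (ω i) := measurable_of_finite _
  rw [← hpi, map_measureReal_apply hfl (measurableSet_le (by fun_prop) (by fun_prop))] at hbe
  classical
  have hset : (fun (ω : Fin n → κ) i => l (ω i)) ⁻¹'
        {ω | √n * (1 / (n : ℝ) * ∑ i, ω i - m) ≤ √v * z}
      = ((Finset.univ.filter fun ω : Fin n → κ => ∑ i, l (ω i) ≤ n * m + √n * √v * z :
          Finset (Fin n → κ)) : Set (Fin n → κ)) := by
    ext ω
    simp only [Set.mem_preimage, Set.mem_ofPred_eq, Finset.coe_filter, Finset.mem_univ, true_and]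
    have hsq : √(n : ℝ) * √(n : ℝ) = n := Real.mul_self_sqrt hn0.le
    have e : √(n : ℝ) * (1 / (n : ℝ) * ∑ i, l (ω i) - m) * √(n : ℝ) = ∑ i, l (ω i) - n * m := by
      rw [mul_right_comm, hsq]; field_simp
    rw [← mul_le_mul_iff_left₀ hs0, e, sub_le_iff_le_add', mul_comm (√v * z), mul_assoc]
  rw [hset, ← sum_measureReal_singleton, Finset.sum_filter] at hbe
  refine le_trans (le_of_eq ?_) hbe
  congr 2
  refine Finset.sum_congr rfl fun ω _ => ?_
  congr 1
  rw [measureReal_def, Measure.pi_singleton, ENNReal.toReal_prod]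
  exact Finset.prod_congr rfl fun i _ => by rw [hsing, ENNReal.toReal_ofReal (hp _)]

/-! ### Tensor powers -/

section Tensor

open Matrix

variable {ι : Type*}

theorem tensorPower_mul [Fintype ι] (n : ℕ) (A B : Matrix ι ι ℂ) :
    tensorPower n (A * B) = tensorPower n A * tensorPower n B := by
  classical
  ext x y
  simp only [tensorPower, of_apply, mul_apply, ← Finset.prod_mul_distrib]
  rw [Finset.prod_univ_sum, Fintype.piFinset_univ]

theorem tensorPower_conjTranspose (n : ℕ) (A : Matrix ι ι ℂ) :
    tensorPower n Aᴴ = (tensorPower n A)ᴴ := by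
  ext x y
  simp [tensorPower, conjTranspose_apply]

variable [DecidableEq ι]

theorem tensorPower_diagonal (n : ℕ) (d : ι → ℂ) :
    tensorPower n (diagonal d) = diagonal fun x => ∏ i, d (x i) := by
  ext x y
  simp only [tensorPower, of_apply, diagonal_apply]
  split_ifs with h
  · subst h; simp
  · obtain ⟨i, hi⟩ := Function.ne_iff.1 h
    exact Finset.prod_eq_zero (Finset.mem_univ i) (if_neg hi)

theorem tensorPower_one (n : ℕ) : tensorPower n (1 : Matrix ι ι ℂ) = 1 := by
  rw [← diagonal_one, tensorPower_diagonal, ← diagonal_one]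
  simp

end Tensor

/-! ### The joint distribution of the eigenvalues -/

section Joint

open Matrix

variable {ι : Type*} [Fintype ι] [DecidableEq ι] {ρ σ : Matrix ι ι ℂ}

/-- The unitary matrix whose columns are the eigenvectors. -/
abbrev eigU (hρ : ρ.IsHermitian) : Matrix ι ι ℂ := hρ.eigenvectorUnitary

theorem eigU_mul_conjTranspose (hρ : ρ.IsHermitian) : eigU hρ * (eigU hρ)ᴴ = 1 :=
  (mem_unitaryGroup_iff).1 hρ.eigenvectorUnitary.2

theorem conjTranspose_mul_eigU (hρ : ρ.IsHermitian) : (eigU hρ)ᴴ * eigU hρ = 1 :=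
  (mem_unitaryGroup_iff').1 hρ.eigenvectorUnitary.2

theorem cfc_eq_eigU (hρ : ρ.IsHermitian) (f : ℝ → ℝ) :
    cfc f ρ = eigU hρ * diagonal (fun x => (f (hρ.eigenvalues x) : ℂ)) * (eigU hρ)ᴴ := by
  rw [hρ.cfc_eq, IsHermitian.cfc, Unitary.conjStarAlgAut_apply]
  rfl

theorem eq_eigU (hρ : ρ.IsHermitian) :
    ρ = eigU hρ * diagonal (fun x => (hρ.eigenvalues x : ℂ)) * (eigU hρ)ᴴ := by
  conv_lhs => rw [hρ.spectral_theorem, Unitary.conjStarAlgAut_apply]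
  rfl

/-- The matrix of the inner products `⟨b_y | a_x⟩`, with row index `y` and column index `x`. -/
def overlap (hρ : ρ.IsHermitian) (hσ : σ.IsHermitian) : Matrix ι ι ℂ := (eigU hσ)ᴴ * eigU hρ

theorem overlap_mul_conjTranspose (hρ : ρ.IsHermitian) (hσ : σ.IsHermitian) :
    overlap hρ hσ * (overlap hρ hσ)ᴴ = 1 := by
  rw [overlap, conjTranspose_mul, conjTranspose_conjTranspose, Matrix.mul_assoc,
    ← Matrix.mul_assoc (eigU hρ), eigU_mul_conjTranspose, Matrix.one_mul, conjTranspose_mul_eigU]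

theorem conjTranspose_mul_overlap (hρ : ρ.IsHermitian) (hσ : σ.IsHermitian) :
    (overlap hρ hσ)ᴴ * overlap hρ hσ = 1 := by
  rw [overlap, conjTranspose_mul, conjTranspose_conjTranspose, Matrix.mul_assoc,
    ← Matrix.mul_assoc (eigU hσ), eigU_mul_conjTranspose, Matrix.one_mul, conjTranspose_mul_eigU]

theorem jointProb_eq (hρ : ρ.IsHermitian) (hσ : σ.IsHermitian) (x y : ι) :
    jointProb hρ hσ x y = hρ.eigenvalues x * ‖overlap hρ hσ y x‖ ^ 2 := by
  have : inner ℂ (hσ.eigenvectorBasis y) (hρ.eigenvectorBasis x) = overlap hρ hσ y x := by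
    simp [overlap, mul_apply, conjTranspose_apply, PiLp.inner_apply, mul_comm,
      IsHermitian.eigenvectorUnitary_apply]
  rw [jointProb, this]

/-- A trace of functions of `ρ` and `σ`, as an expectation. -/
theorem trace_functions_re (hρ : ρ.IsHermitian) (hσ : σ.IsHermitian) (f g : ι → ℝ) :
    ((eigU hρ * diagonal (fun x => (f x : ℂ)) * (eigU hρ)ᴴ)
      * (eigU hσ * diagonal (fun y => (g y : ℂ)) * (eigU hσ)ᴴ)).trace.re
      = ∑ x, ∑ y, f x * g y * ‖overlap hρ hσ y x‖ ^ 2 := by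
  have e : ((eigU hρ * diagonal (fun x => (f x : ℂ)) * (eigU hρ)ᴴ)
      * (eigU hσ * diagonal (fun y => (g y : ℂ)) * (eigU hσ)ᴴ)).trace
      = (overlap hρ hσ * diagonal (fun x => (f x : ℂ)) * (overlap hρ hσ)ᴴ
        * diagonal (fun y => (g y : ℂ))).trace := by
    rw [← Matrix.mul_assoc, Matrix.trace_mul_comm, overlap, conjTranspose_mul,
      conjTranspose_conjTranspose]
    simp only [Matrix.mul_assoc]
  rw [e, trace_conj_diagonal_mul_re]
  refine Finset.sum_congr rfl fun x _ => ?_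
  simp only [dotProduct, mulVec_diagonal, Pi.star_apply, RCLike.star_def, Complex.re_sum,
    Finset.mul_sum]
  refine Finset.sum_congr rfl fun y _ => ?_
  have : (starRingEnd ℂ) (overlap hρ hσ y x) * ((g y : ℂ) * overlap hρ hσ y x)
      = ((g y * ‖overlap hρ hσ y x‖ ^ 2 : ℝ) : ℂ) := by
    rw [mul_left_comm, Complex.conj_mul']; push_cast; ring
  rw [this, Complex.ofReal_re]
  ring

theorem sum_overlap (hρ : ρ.IsHermitian) (hσ : σ.IsHermitian) (x : ι) :
    ∑ y, ‖overlap hρ hσ y x‖ ^ 2 = 1 := by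
  have := congrFun (congrFun (conjTranspose_mul_overlap hρ hσ) x) x
  simp only [mul_apply, conjTranspose_apply, RCLike.star_def, Complex.conj_mul', one_apply_eq] at this
  exact_mod_cast this

theorem sum_eigenvalues (hρ : IsDensityMatrix ρ) : ∑ x, hρ.isHermitian.eigenvalues x = 1 := by
  have := hρ.isHermitian.trace_eq_sum_eigenvalues
  rw [hρ.2] at this
  have h2 := congrArg Complex.re this
  simpa using h2.symm

theorem sum_jointProb (hρ : IsDensityMatrix ρ) (hσ : σ.IsHermitian) :
    ∑ x, ∑ y, jointProb hρ.isHermitian hσ x y = 1 := by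
  simp only [jointProb_eq, ← Finset.mul_sum, sum_overlap, mul_one]
  exact sum_eigenvalues hρ

/-- On the support of the joint distribution both eigenvalues are positive; this is where
`supp ρ ⊆ supp σ` enters. -/
theorem eigenvalues_pos_of_jointProb_ne_zero (hρ : IsDensityMatrix ρ) (hσ : IsDensityMatrix σ)
    (hsupp : supp ρ ≤ supp σ) {x y : ι} (h : jointProb hρ.isHermitian hσ.isHermitian x y ≠ 0) :
    0 < hρ.isHermitian.eigenvalues x ∧ 0 < hσ.isHermitian.eigenvalues y := by
  rw [jointProb_eq] at h
  have hx := left_ne_zero_of_mul h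
  have ho : overlap hρ.isHermitian hσ.isHermitian y x ≠ 0 := fun h0 =>
    right_ne_zero_of_mul h (by simp [h0])
  refine ⟨lt_of_le_of_ne (hρ.1.eigenvalues_nonneg x) (Ne.symm hx),
    lt_of_le_of_ne (hσ.1.eigenvalues_nonneg y) fun hy => ho ?_⟩
  set a : ι → ℂ := fun i => eigU hρ.isHermitian i x with ha
  set b : ι → ℂ := fun i => eigU hσ.isHermitian i y with hb
  have hρa : ρ *ᵥ a = hρ.isHermitian.eigenvalues x • a :=
    hρ.isHermitian.mulVec_eigenvectorBasis x
  have hσb : σ *ᵥ b = 0 := by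
    have := hσ.isHermitian.mulVec_eigenvectorBasis y
    rw [← hy, zero_smul] at this
    exact this
  obtain ⟨v, hv⟩ := hsupp (⟨a, rfl⟩ : ρ *ᵥ a ∈ supp ρ)
  have h1 : star b ⬝ᵥ ρ *ᵥ a = 0 := by
    rw [← hv, mulVecLin_apply, dotProduct_mulVec]
    have := star_mulVec σ b
    rw [hσb, hσ.isHermitian.eq, star_zero] at this
    rw [← this, zero_dotProduct]
  rw [hρa, dotProduct_smul] at h1
  exact (smul_eq_zero.1 h1).resolve_left hx

/-- `D` and `V` are the mean and the variance of the log-likelihood ratio under the joint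
distribution. -/
theorem relEntropy_relVariance_eq (hρ : IsDensityMatrix ρ) (hσ : IsDensityMatrix σ)
    (hsupp : supp ρ ≤ supp σ) :
    relEntropy ρ σ = ∑ x, ∑ y, jointProb hρ.isHermitian hσ.isHermitian x y *
        Real.log (hρ.isHermitian.eigenvalues x / hσ.isHermitian.eigenvalues y) ∧
    relVariance ρ σ = ∑ x, ∑ y, jointProb hρ.isHermitian hσ.isHermitian x y *
        Real.log (hρ.isHermitian.eigenvalues x / hσ.isHermitian.eigenvalues y) ^ 2
        - relEntropy ρ σ ^ 2 := by
  set hρ' := hρ.isHermitian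
  set hσ' := hσ.isHermitian
  set lam := hρ'.eigenvalues with hlam
  set mu := hσ'.eigenvalues with hmu
  set F : (ι → ℝ) → Matrix ι ι ℂ := fun f => eigU hρ' * diagonal (fun x => (f x : ℂ)) * (eigU hρ')ᴴ
    with hF
  set G : (ι → ℝ) → Matrix ι ι ℂ := fun g => eigU hσ' * diagonal (fun x => (g x : ℂ)) * (eigU hσ')ᴴ
    with hG
  have hFm : ∀ f g, F f * F g = F fun x => f x * g x := fun f g => by
    simp only [hF]
    rw [Matrix.mul_assoc, ← Matrix.mul_assoc _ (eigU hρ' * _), ← Matrix.mul_assoc (eigU hρ')ᴴ,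
      conjTranspose_mul_eigU, Matrix.one_mul, ← Matrix.mul_assoc, Matrix.mul_assoc (eigU hρ'),
      diagonal_mul_diagonal]
    simp only [Complex.ofReal_mul]
  have hGm : ∀ f g, G f * G g = G fun x => f x * g x := fun f g => by
    simp only [hG]
    rw [Matrix.mul_assoc, ← Matrix.mul_assoc _ (eigU hσ' * _), ← Matrix.mul_assoc (eigU hσ')ᴴ,
      conjTranspose_mul_eigU, Matrix.one_mul, ← Matrix.mul_assoc, Matrix.mul_assoc (eigU hσ'),
      diagonal_mul_diagonal]
    simp only [Complex.ofReal_mul]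
  have hG1 : G (fun _ => 1) = 1 := by
    simp only [hG, Complex.ofReal_one, diagonal_one, Matrix.mul_one]
    exact eigU_mul_conjTranspose hσ'
  have htr : ∀ f g, (F f * G g).trace.re = ∑ x, ∑ y, f x * g y * ‖overlap hρ' hσ' y x‖ ^ 2 :=
    trace_functions_re hρ' hσ'
  have htr1 : ∀ f, (F f).trace.re = ∑ x, ∑ y, f x * 1 * ‖overlap hρ' hσ' y x‖ ^ 2 := fun f => by
    rw [← htr, hG1, Matrix.mul_one]
  have hρF : ρ = F lam := eq_eigU hρ'
  have hLρ : matLog ρ = F fun x => Real.log (lam x) := cfc_eq_eigU hρ' Real.log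
  have hLσ : matLog σ = G fun x => Real.log (mu x) := cfc_eq_eigU hσ' Real.log
  have hlog : ∀ x y (φ : ℝ → ℝ), jointProb hρ' hσ' x y * φ (Real.log (lam x / mu y))
      = jointProb hρ' hσ' x y * φ (Real.log (lam x) - Real.log (mu y)) := fun x y φ => by
    by_cases h : jointProb hρ' hσ' x y = 0
    · simp [h]
    · obtain ⟨h1, h2⟩ := eigenvalues_pos_of_jointProb_ne_zero hρ hσ hsupp h
      rw [Real.log_div h1.ne' h2.ne']
  constructor
  · rw [relEntropy, Matrix.mul_sub, Matrix.trace_sub, Complex.sub_re, hLρ, hLσ]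
    conv_lhs => rw [hρF]
    rw [hFm, htr1, htr]
    simp only [← Finset.sum_sub_distrib]
    refine Finset.sum_congr rfl fun x _ => Finset.sum_congr rfl fun y _ => ?_
    rw [hlog x y fun t => t, jointProb_eq]
    ring
  · rw [relVariance]
    congr 1
    have e : (ρ * (matLog ρ - matLog σ) ^ 2).trace
        = (ρ * (matLog ρ * matLog ρ)).trace - (ρ * matLog ρ * matLog σ).trace
          - (matLog ρ * ρ * matLog σ).trace + (ρ * (matLog σ * matLog σ)).trace := by
      have : (ρ * (matLog σ * matLog ρ)).trace = (matLog ρ * ρ * matLog σ).trace := by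
        rw [← Matrix.mul_assoc, Matrix.trace_mul_comm, ← Matrix.mul_assoc]
      rw [← this, pow_two]
      simp only [Matrix.mul_sub, Matrix.sub_mul, Matrix.trace_sub, Matrix.mul_assoc]
      ring
    rw [e, Complex.add_re, Complex.sub_re, Complex.sub_re, hLρ, hLσ]
    conv_lhs => rw [hρF]
    rw [hFm, hFm, hFm, hFm, hGm, htr1, htr, htr, htr]
    simp only [← Finset.sum_sub_distrib, ← Finset.sum_add_distrib]
    refine Finset.sum_congr rfl fun x _ => Finset.sum_congr rfl fun y _ => ?_
    rw [hlog x y fun t => t ^ 2, jointProb_eq]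
    ring

end Joint

/-! ### Bounds for the minimal error of the second kind -/

section Bounds

open Matrix

theorem sum_sum_eq_sum_prod {ι : Type*} [Fintype ι] (n : ℕ) (g : (Fin n → ι) → (Fin n → ι) → ℝ) :
    ∑ x, ∑ y, g x y = ∑ ω : Fin n → ι × ι, g (fun i => (ω i).1) fun i => (ω i).2 := by
  rw [← Fintype.sum_prod_type']
  exact ((Equiv.arrowProdEquivProdArrow (Fin n) (fun _ => ι) (fun _ => ι)).sum_comp
    fun p => g p.1 p.2).symm

variable {ι : Type*} [Fintype ι] [DecidableEq ι] {ρ σ : Matrix ι ι ℂ}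

theorem jointProb_nonneg (hρ : IsDensityMatrix ρ) (hσ : σ.IsHermitian) (x y : ι) :
    0 ≤ jointProb hρ.isHermitian hσ x y :=
  mul_nonneg (hρ.1.eigenvalues_nonneg x) (by positivity)

/-- The distribution function of the log-likelihood ratio of `n` independent copies of the joint
distribution is close to the normal one. -/
theorem abs_logLikelihood_sub_normalCDF_le (hρ : IsDensityMatrix ρ) (hσ : IsDensityMatrix σ)
    (hsupp : supp ρ ≤ supp σ) (hV : 0 < relVariance ρ σ) {n : ℕ} (hn : 1 ≤ n) (z : ℝ) :
    |(∑ x : Fin n → ι, ∑ y : Fin n → ι,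
        if ∑ i, Real.log (hρ.isHermitian.eigenvalues (x i) / hσ.isHermitian.eigenvalues (y i))
            ≤ n * relEntropy ρ σ + √n * √(relVariance ρ σ) * z
          then ∏ i, jointProb hρ.isHermitian hσ.isHermitian (x i) (y i) else 0) - normalCDF z|
      ≤ 1 / √n * (berryEsseenConstant * absThirdMoment hρ.isHermitian hσ.isHermitian
          / √(relVariance ρ σ) ^ 3) := by
  rw [one_div_mul_eq_div, div_div, mul_comm _ √(n : ℝ)]
  obtain ⟨hD, hVd⟩ := relEntropy_relVariance_eq hρ hσ hsupp
  rw [sum_sum_eq_sum_prod]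
  refine abs_sum_prod_sub_normalCDF_le
    (p := fun k : ι × ι => jointProb hρ.isHermitian hσ.isHermitian k.1 k.2)
    (fun k => jointProb_nonneg hρ _ _ _) ?_
    (fun k => Real.log (hρ.isHermitian.eigenvalues k.1 / hσ.isHermitian.eigenvalues k.2))
    ?_ ?_ hV ?_ hn z
  · rw [Fintype.sum_prod_type, sum_jointProb hρ]
  · rw [Fintype.sum_prod_type, hD]
  · rw [Fintype.sum_prod_type, hVd]
  · rw [Fintype.sum_prod_type, absThirdMoment]

theorem sum_prod_jointProb (hρ : IsDensityMatrix ρ) (hσ : σ.IsHermitian) (n : ℕ) :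
    ∑ x : Fin n → ι, ∑ y : Fin n → ι, ∏ i, jointProb hρ.isHermitian hσ (x i) (y i) = 1 := by
  rw [sum_sum_eq_sum_prod]
  have := Finset.prod_univ_sum (fun _ : Fin n => (Finset.univ : Finset (ι × ι)))
    fun _ k => jointProb hρ.isHermitian hσ k.1 k.2
  rw [Fintype.piFinset_univ] at this
  rw [← this, Fintype.sum_prod_type, sum_jointProb hρ hσ]
  simp

theorem sum_prod_eigenvalues (hρ : IsDensityMatrix ρ) (n : ℕ) :
    ∑ x : Fin n → ι, ∏ i, hρ.isHermitian.eigenvalues (x i) = 1 := by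
  have := Finset.prod_univ_sum (fun _ : Fin n => (Finset.univ : Finset ι))
    fun _ k => hρ.isHermitian.eigenvalues k
  rw [Fintype.piFinset_univ] at this
  rw [← this, sum_eigenvalues hρ]
  simp

theorem prod_eigenvalues_mul (hρ : ρ.IsHermitian) (hσ : σ.IsHermitian) {n : ℕ} (x y : Fin n → ι) :
    (∏ i, hρ.eigenvalues (x i)) * ‖tensorPower n (overlap hρ hσ) y x‖ ^ 2
      = ∏ i, jointProb hρ hσ (x i) (y i) := by
  simp only [jointProb_eq, Finset.prod_mul_distrib, tensorPower, of_apply, norm_prod,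
    Finset.prod_pow]

theorem tensorPower_eq (hρ : ρ.IsHermitian) (n : ℕ) :
    tensorPower n ρ = tensorPower n (eigU hρ)
      * diagonal (fun x => ((∏ i, hρ.eigenvalues (x i) : ℝ) : ℂ)) * (tensorPower n (eigU hρ))ᴴ := by
  conv_lhs => rw [eq_eigU hρ, tensorPower_mul, tensorPower_mul, tensorPower_conjTranspose,
    tensorPower_diagonal]
  simp only [Complex.ofReal_prod]

theorem typeIError_eq (hρ : IsDensityMatrix ρ) (n : ℕ) (A : Matrix (Fin n → ι) (Fin n → ι) ℂ) :
    typeIError ρ n A = 1 - (tensorPower n ρ * A).trace.re := by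
  have h : (tensorPower n ρ).trace.re = 1 := by
    have := trace_diagonal_mul_re (fun x : Fin n → ι => ∏ i, hρ.isHermitian.eigenvalues (x i)) 1
    simp only [one_apply_eq, Complex.one_re, mul_one, sum_prod_eigenvalues hρ] at this
    rw [tensorPower_eq hρ.isHermitian, Matrix.mul_assoc, Matrix.trace_mul_comm, Matrix.mul_assoc,
      ← tensorPower_conjTranspose, ← tensorPower_mul, conjTranspose_mul_eigU, tensorPower_one,
      Matrix.mul_one, this]
  rw [typeIError, Matrix.mul_sub, Matrix.mul_one, Matrix.trace_sub, Complex.sub_re, h]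

/-- In the eigenbasis of the second state, both error probabilities take the form of the one-shot
bounds. -/
theorem trace_eigenbasis (hρ : ρ.IsHermitian) (hσ : σ.IsHermitian) {n : ℕ}
    (B : Matrix (Fin n → ι) (Fin n → ι) ℂ) :
    let W := tensorPower n (eigU hσ)
    let M := tensorPower n (overlap hρ hσ)
    (tensorPower n ρ * (W * B * Wᴴ)).trace
        = (M * diagonal (fun x : Fin n → ι => ((∏ i, hρ.eigenvalues (x i) : ℝ) : ℂ)) * Mᴴ * B).trace ∧
      (tensorPower n σ * (W * B * Wᴴ)).trace
        = (diagonal (fun x : Fin n → ι => ((∏ i, hσ.eigenvalues (x i) : ℝ) : ℂ)) * B).trace := by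
  intro W M
  have hW : Wᴴ * W = 1 := by
    rw [← tensorPower_conjTranspose, ← tensorPower_mul, conjTranspose_mul_eigU, tensorPower_one]
  have hM : M = Wᴴ * tensorPower n (eigU hρ) := by
    rw [← tensorPower_conjTranspose, ← tensorPower_mul]
    rfl
  constructor
  · rw [tensorPower_eq hρ, ← Matrix.mul_assoc, Matrix.trace_mul_comm, hM, conjTranspose_mul,
      conjTranspose_conjTranspose]
    simp only [Matrix.mul_assoc]
  · rw [tensorPower_eq hσ, ← Matrix.mul_assoc, Matrix.trace_mul_comm]
    simp only [← Matrix.mul_assoc]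
    rw [hW, Matrix.one_mul, Matrix.mul_assoc, Matrix.mul_assoc, ← Matrix.mul_assoc Wᴴ, hW,
      Matrix.one_mul]

theorem isTest_conj {κ : Type*} [Fintype κ] [DecidableEq κ] {B W : Matrix κ κ ℂ} (hB : IsTest B)
    (hW : W * Wᴴ = 1) : IsTest (W * B * Wᴴ) := by
  refine ⟨hB.1.mul_mul_conjTranspose_same W, ?_⟩
  have := hB.2.mul_mul_conjTranspose_same W
  rwa [Matrix.mul_sub, Matrix.sub_mul, Matrix.mul_one, hW] at this

/-- The direct part in terms of the log-likelihood ratio. -/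
theorem minTypeII_le_inv (hρ : IsDensityMatrix ρ) (hσ : IsDensityMatrix σ) (hsupp : supp ρ ≤ supp σ)
    {n : ℕ} {ε L : ℝ} (hL : 0 < L) (hε0 : 0 ≤ ε)
    (hε : (∑ x : Fin n → ι, ∑ y : Fin n → ι,
        if ∑ i, Real.log (hρ.isHermitian.eigenvalues (x i) / hσ.isHermitian.eigenvalues (y i))
            ≤ Real.log L
          then ∏ i, jointProb hρ.isHermitian hσ.isHermitian (x i) (y i) else 0) ≤ ε) :
    minTypeII ρ σ n ε ≤ 1 / L := by
  set hρ' := hρ.isHermitian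
  set hσ' := hσ.isHermitian
  set lam : (Fin n → ι) → ℝ := fun x => ∏ i, hρ'.eigenvalues (x i) with hlam
  set mu : (Fin n → ι) → ℝ := fun x => ∏ i, hσ'.eigenvalues (x i) with hmu
  obtain ⟨B, hB, h2, h1⟩ := exists_test lam mu
    (fun x => Finset.prod_nonneg fun i _ => hρ.1.eigenvalues_nonneg _)
    (tensorPower n (overlap hρ' hσ')) hL
  set W := tensorPower n (eigU hσ') with hW
  have hWW : W * Wᴴ = 1 := by
    rw [hW, ← tensorPower_conjTranspose, ← tensorPower_mul, eigU_mul_conjTranspose, tensorPower_one]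
  obtain ⟨t1, t2⟩ := trace_eigenbasis hρ' hσ' B
  rw [sum_prod_eigenvalues hρ n] at h2
  refine ((isLeast_minTypeII ρ σ n hε0).2 ⟨W * B * Wᴴ, ⟨isTest_conj hB hWW, ?_⟩, rfl⟩).trans ?_
  · rw [typeIError_eq hρ, t1]
    refine le_trans ?_ hε
    rw [sub_le_comm, ← sum_prod_jointProb hρ hσ' n, ← Finset.sum_sub_distrib]
    refine le_trans (Finset.sum_le_sum fun x _ => ?_) h1
    rw [← Finset.sum_sub_distrib]
    refine Finset.sum_le_sum fun y _ => ?_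
    rw [show lam x * _ = _ from prod_eigenvalues_mul hρ' hσ' x y]
    have hnn : 0 ≤ ∏ i, jointProb hρ' hσ' (x i) (y i) :=
      Finset.prod_nonneg fun i _ => jointProb_nonneg hρ _ _ _
    rcases hnn.eq_or_lt with h0 | h0
    · rw [← h0]; simp
    have hpos := fun i => eigenvalues_pos_of_jointProb_ne_zero hρ hσ hsupp
      (Finset.prod_ne_zero_iff.1 h0.ne' i (Finset.mem_univ i))
    by_cases h : L * mu y ≤ lam x
    · rw [if_pos h]
      split_ifs <;> simp [hnn]
    · rw [if_neg h, if_pos, sub_self]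
      have hmu0 : 0 < mu y := Finset.prod_pos fun i _ => (hpos i).2
      have hlam0 : 0 < lam x := Finset.prod_pos fun i _ => (hpos i).1
      rw [← Real.log_prod fun i _ => (div_pos (hpos i).1 (hpos i).2).ne', Finset.prod_div_distrib]
      refine Real.log_le_log (div_pos hlam0 hmu0) ?_
      exact (div_le_iff₀ hmu0).2 (not_le.1 h).le
  · rw [typeIIError, t2]
    exact h2

theorem minTypeII_nonneg (hσ : IsDensityMatrix σ) (ρ : Matrix ι ι ℂ) {n : ℕ} {ε : ℝ} (hε0 : 0 ≤ ε) :
    0 ≤ minTypeII ρ σ n ε := by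
  obtain ⟨A, ⟨hA, -⟩, h⟩ := (isLeast_minTypeII ρ σ n hε0).1
  obtain ⟨K, hK⟩ := hA.1.exists_eq_conjTranspose_mul_self
  rw [← h, typeIIError, tensorPower_eq hσ.isHermitian, trace_conj_diagonal_mul_re]
  refine Finset.sum_nonneg fun x _ => mul_nonneg
    (Finset.prod_nonneg fun i _ => hσ.1.eigenvalues_nonneg _) ?_
  rw [hK, dotProduct_conjTranspose_mul_self_mulVec, Complex.ofReal_re]
  exact nsq_nonneg _

/-- The converse part for `n` copies, for an optimal test. -/
theorem one_sub_le_minTypeII (hρ : IsDensityMatrix ρ) (hσ : IsDensityMatrix σ) {n : ℕ} {ε L t : ℝ}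
    (hL : 0 ≤ L) (ht : 0 < t) (hε0 : 0 ≤ ε) :
    1 - ε ≤ (1 + t) * (∑ x : Fin n → ι, ∑ y : Fin n → ι,
        if L * ∏ i, hσ.isHermitian.eigenvalues (y i) < ∏ i, hρ.isHermitian.eigenvalues (x i)
          then ∏ i, jointProb hρ.isHermitian hσ.isHermitian (x i) (y i) else 0)
      + (1 + 1 / t) * (4 * L * minTypeII ρ σ n ε) := by
  obtain ⟨A, ⟨hA, hAε⟩, hmin⟩ := (isLeast_minTypeII ρ σ n hε0).1
  set hρ' := hρ.isHermitian
  set hσ' := hσ.isHermitian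
  set W := tensorPower n (eigU hσ') with hW
  have hWW : W * Wᴴ = 1 := by
    rw [hW, ← tensorPower_conjTranspose, ← tensorPower_mul, eigU_mul_conjTranspose, tensorPower_one]
  have hWW' : Wᴴ * W = 1 := mul_eq_one_comm.1 hWW
  have hB : IsTest (Wᴴ * A * W) := by
    have := isTest_conj (W := Wᴴ) hA (by rwa [conjTranspose_conjTranspose])
    rwa [conjTranspose_conjTranspose] at this
  have hAB : W * (Wᴴ * A * W) * Wᴴ = A := by
    simp only [Matrix.mul_assoc, hWW, Matrix.mul_one]
    rw [← Matrix.mul_assoc, hWW, Matrix.one_mul]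
  obtain ⟨t1, t2⟩ := trace_eigenbasis hρ' hσ' (Wᴴ * A * W)
  rw [← hW, hAB] at t1 t2
  have hM : tensorPower n (overlap hρ' hσ') * (tensorPower n (overlap hρ' hσ'))ᴴ = 1 := by
    rw [← tensorPower_conjTranspose, ← tensorPower_mul, overlap_mul_conjTranspose, tensorPower_one]
  have key := test_power_le (lam := fun x : Fin n → ι => ∏ i, hρ'.eigenvalues (x i))
    (mu := fun x : Fin n → ι => ∏ i, hσ'.eigenvalues (x i))
    (fun x => Finset.prod_nonneg fun i _ => hρ.1.eigenvalues_nonneg _)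
    (fun x => Finset.prod_nonneg fun i _ => hσ.1.eigenvalues_nonneg _) hM hB hL ht
  rw [← t1, ← t2] at key
  simp only [prod_eigenvalues_mul] at key
  rw [typeIError_eq hρ] at hAε
  rw [typeIIError] at hmin
  rw [hmin] at key
  linarith

/-- For `ε < 1` the error of the second kind cannot vanish: otherwise the converse part, for a
threshold above all likelihood ratios, gives `1 - ε ≤ 0`. -/
theorem minTypeII_pos (hρ : IsDensityMatrix ρ) (hσ : IsDensityMatrix σ) (hsupp : supp ρ ≤ supp σ)
    {n : ℕ} {ε : ℝ} (hε0 : 0 ≤ ε) (hε1 : ε < 1) : 0 < minTypeII ρ σ n ε := by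
  refine lt_of_le_of_ne (minTypeII_nonneg hσ ρ hε0) fun h0 => ?_
  set lam : (Fin n → ι) → ℝ := fun x => ∏ i, hρ.isHermitian.eigenvalues (x i) with hlam
  set mu : (Fin n → ι) → ℝ := fun x => ∏ i, hσ.isHermitian.eigenvalues (x i) with hmu
  have hlam0 : ∀ x, 0 ≤ lam x := fun x => Finset.prod_nonneg fun i _ => hρ.1.eigenvalues_nonneg _
  have hmu0 : ∀ x, 0 ≤ mu x := fun x => Finset.prod_nonneg fun i _ => hσ.1.eigenvalues_nonneg _
  have hq : ∀ x y, 0 ≤ lam x / mu y := fun x y => div_nonneg (hlam0 x) (hmu0 y)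
  -- a threshold above all likelihood ratios
  set L := ∑ x, ∑ y, lam x / mu y with hL
  have hL0 : 0 ≤ L := Finset.sum_nonneg fun x _ => Finset.sum_nonneg fun y _ => hq x y
  have h := one_sub_le_minTypeII hρ hσ (n := n) hL0 one_pos hε0
  rw [← h0, mul_zero, mul_zero, add_zero, Finset.sum_eq_zero, mul_zero] at h
  · linarith
  intro x _
  refine Finset.sum_eq_zero fun y _ => ?_
  by_cases hp : ∏ i, jointProb hρ.isHermitian hσ.isHermitian (x i) (y i) = 0
  · simp [hp]
  · refine if_neg (not_lt.2 ?_)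
    have hpos := fun i => eigenvalues_pos_of_jointProb_ne_zero hρ hσ hsupp
      (Finset.prod_ne_zero_iff.1 hp i (Finset.mem_univ i))
    have hmuy : 0 < mu y := Finset.prod_pos fun i _ => (hpos i).2
    have hle : lam x / mu y ≤ L :=
      (Finset.single_le_sum (fun y _ => hq x y) (Finset.mem_univ y)).trans
        (Finset.single_le_sum (f := fun x => ∑ y, lam x / mu y)
          (fun x _ => Finset.sum_nonneg fun y _ => hq x y) (Finset.mem_univ x))
    exact (div_le_iff₀ hmuy).1 hle

/-- The converse part in terms of the log-likelihood ratio. -/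
theorem one_sub_le_of_log (hρ : IsDensityMatrix ρ) (hσ : IsDensityMatrix σ)
    (hsupp : supp ρ ≤ supp σ) {n : ℕ} {ε L t : ℝ} (hL : 0 < L) (ht : 0 < t) (hε0 : 0 ≤ ε) :
    (∑ x : Fin n → ι, ∑ y : Fin n → ι,
        if ∑ i, Real.log (hρ.isHermitian.eigenvalues (x i) / hσ.isHermitian.eigenvalues (y i))
            ≤ Real.log L
          then ∏ i, jointProb hρ.isHermitian hσ.isHermitian (x i) (y i) else 0)
      ≤ ε + t + (1 + 1 / t) * (4 * L * minTypeII ρ σ n ε) := by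
  have h := one_sub_le_minTypeII hρ hσ (n := n) hL.le ht hε0
  set q := ∑ x : Fin n → ι, ∑ y : Fin n → ι,
        if L * ∏ i, hσ.isHermitian.eigenvalues (y i) < ∏ i, hρ.isHermitian.eigenvalues (x i)
          then ∏ i, jointProb hρ.isHermitian hσ.isHermitian (x i) (y i) else 0 with hq
  set r := ∑ x : Fin n → ι, ∑ y : Fin n → ι,
        if ∑ i, Real.log (hρ.isHermitian.eigenvalues (x i) / hσ.isHermitian.eigenvalues (y i))
            ≤ Real.log L
          then ∏ i, jointProb hρ.isHermitian hσ.isHermitian (x i) (y i) else 0 with hr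
  have hnn : ∀ x y : Fin n → ι, 0 ≤ ∏ i, jointProb hρ.isHermitian hσ.isHermitian (x i) (y i) :=
    fun x y => Finset.prod_nonneg fun i _ => jointProb_nonneg hρ _ _ _
  have hqr : q + r ≤ 1 := by
    rw [← sum_prod_jointProb hρ hσ.isHermitian n, hq, hr, ← Finset.sum_add_distrib]
    refine Finset.sum_le_sum fun x _ => ?_
    rw [← Finset.sum_add_distrib]
    refine Finset.sum_le_sum fun y _ => ?_
    rcases (hnn x y).eq_or_lt with h0 | h0
    · rw [← h0]; simp
    have hpos := fun i => eigenvalues_pos_of_jointProb_ne_zero hρ hσ hsupp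
      (Finset.prod_ne_zero_iff.1 h0.ne' i (Finset.mem_univ i))
    by_cases hlt : L * ∏ i, hσ.isHermitian.eigenvalues (y i) < ∏ i, hρ.isHermitian.eigenvalues (x i)
    · rw [if_pos hlt, if_neg, add_zero]
      rw [← Real.log_prod fun i _ => (div_pos (hpos i).1 (hpos i).2).ne', Finset.prod_div_distrib,
        not_le]
      exact Real.log_lt_log hL ((lt_div_iff₀ (Finset.prod_pos fun i _ => (hpos i).2)).2 hlt)
    · rw [if_neg hlt, zero_add]
      split_ifs
      · exact le_rfl
      · exact h0.le
  have hr0 : 0 ≤ r := Finset.sum_nonneg fun x _ => Finset.sum_nonneg fun y _ => by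
    split_ifs
    · exact hnn x y
    · exact le_rfl
  nlinarith

end Bounds

/-! ### Second-order bounds for the error exponent -/

theorem negLog_of_pos {x : ℝ} (hx : 0 < x) : negLog x = ((-Real.log x : ℝ) : EReal) := by
  rw [negLog, ENNReal.log_ofReal_of_pos hx, EReal.coe_neg]

theorem negLog_of_nonpos {x : ℝ} (hx : x ≤ 0) : negLog x = ⊤ := by
  rw [negLog, ENNReal.ofReal_of_nonpos hx, ENNReal.log_zero, EReal.neg_bot]

theorem coe_le_negLog {a x : ℝ} (h : x ≤ Real.exp (-a)) : (a : EReal) ≤ negLog x := by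
  rcases le_or_gt x 0 with h0 | h0
  · rw [negLog_of_nonpos h0]; exact le_top
  · rw [negLog_of_pos h0, EReal.coe_le_coe_iff]
    have := (Real.log_le_iff_le_exp h0).2 h
    linarith

section

variable {ι : Type*} [Fintype ι] [DecidableEq ι] {ρ σ : Matrix ι ι ℂ}

theorem berryEsseen_error_nonneg (hρ : IsDensityMatrix ρ) (hσ : IsDensityMatrix σ)
    (hsupp : supp ρ ≤ supp σ) (hV : 0 < relVariance ρ σ) {n : ℕ} (hn : 1 ≤ n) :
    0 ≤ 1 / √n * (berryEsseenConstant * absThirdMoment hρ.isHermitian hσ.isHermitian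
      / √(relVariance ρ σ) ^ 3) :=
  (abs_nonneg _).trans (abs_logLikelihood_sub_normalCDF_le hρ hσ hsupp hV hn 0)

/-- The lower bound for the error exponent, from the likelihood ratio threshold
`exp (n D + √(n V) z)` with `Φ(z) = ε - δ`. -/
theorem le_negLog_minTypeII (hρ : IsDensityMatrix ρ) (hσ : IsDensityMatrix σ)
    (hsupp : supp ρ ≤ supp σ) (hV : 0 < relVariance ρ σ) {ε : ℝ} (hε : ε ∈ Set.Icc (0 : ℝ) 1)
    {n : ℕ} (hn : 1 ≤ n) :
    ((n * relEntropy ρ σ : ℝ) : EReal) + ((√n * √(relVariance ρ σ) : ℝ) : EReal) *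
        normalQuantile (ε - 1 / √n * (berryEsseenConstant *
          absThirdMoment hρ.isHermitian hσ.isHermitian / √(relVariance ρ σ) ^ 3))
      ≤ negLog (minTypeII ρ σ n ε) := by
  have hδ0 := berryEsseen_error_nonneg hρ hσ hsupp hV hn
  have hbe := abs_logLikelihood_sub_normalCDF_le hρ hσ hsupp hV hn
  set δ := 1 / √n * (berryEsseenConstant * absThirdMoment hρ.isHermitian hσ.isHermitian
      / √(relVariance ρ σ) ^ 3) with hδ
  have hc : 0 < √n * √(relVariance ρ σ) :=
    mul_pos (Real.sqrt_pos.2 (by exact_mod_cast hn)) (Real.sqrt_pos.2 hV)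
  rcases le_or_gt (ε - δ) 0 with h0 | h0
  · rw [normalQuantile_of_nonpos h0, EReal.coe_mul_bot_of_pos hc, EReal.add_bot]
    exact bot_le
  rcases le_or_gt 1 (ε - δ) with h1 | h1
  · -- here `ε = 1`, and the trivial test `A = 0` is admissible
    have hε1 : ε = 1 := le_antisymm hε.2 (by linarith)
    have hle : minTypeII ρ σ n ε ≤ 0 := by
      refine (isLeast_minTypeII ρ σ n hε.1).2 ⟨0, ⟨⟨Matrix.PosSemidef.zero, ?_⟩, ?_⟩, ?_⟩
      · rw [sub_zero]; exact Matrix.PosSemidef.one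
      · rw [typeIError_eq hρ, hε1]; simp
      · simp [typeIIError]
    rw [negLog_of_nonpos hle]
    exact le_top
  · obtain ⟨z, hz⟩ := exists_normalCDF_eq h0 h1
    rw [← hz, normalQuantile_normalCDF, ← EReal.coe_mul, ← EReal.coe_add]
    refine coe_le_negLog ?_
    have h := minTypeII_le_inv hρ hσ hsupp (n := n) (ε := ε)
      (Real.exp_pos (n * relEntropy ρ σ + √n * √(relVariance ρ σ) * z)) hε.1 (by
        rw [Real.log_exp]
        linarith [(abs_le.1 (hbe z)).2])
    rwa [one_div, ← Real.exp_neg] at h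

/-- The upper bound for the error exponent, from the likelihood ratio threshold `1 / (8 n β)`. -/
theorem negLog_minTypeII_le (hρ : IsDensityMatrix ρ) (hσ : IsDensityMatrix σ)
    (hsupp : supp ρ ≤ supp σ) (hV : 0 < relVariance ρ σ) {ε : ℝ} (hε0 : 0 ≤ ε)
    {n : ℕ} (hn : 1 ≤ n)
    (hε : ε + 1 / √n * (berryEsseenConstant * absThirdMoment hρ.isHermitian hσ.isHermitian
      / √(relVariance ρ σ) ^ 3 + 2) ≤ 1) :
    negLog (minTypeII ρ σ n ε) ≤
      ((n * relEntropy ρ σ : ℝ) : EReal) + ((√n * √(relVariance ρ σ) : ℝ) : EReal) *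
        normalQuantile (ε + 1 / √n * (berryEsseenConstant *
          absThirdMoment hρ.isHermitian hσ.isHermitian / √(relVariance ρ σ) ^ 3 + 2))
        + ((Real.log (2 ^ 9 * (n : ℝ) ^ 2) : ℝ) : EReal) := by
  have hδ0 := berryEsseen_error_nonneg hρ hσ hsupp hV hn
  have hbe := abs_logLikelihood_sub_normalCDF_le hρ hσ hsupp hV hn
  rw [mul_add] at hε ⊢
  set δ := 1 / √n * (berryEsseenConstant * absThirdMoment hρ.isHermitian hσ.isHermitian
      / √(relVariance ρ σ) ^ 3) with hδ
  have hn1 : (1 : ℝ) ≤ n := by exact_mod_cast hn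
  have hs1 : 1 ≤ √(n : ℝ) := Real.one_le_sqrt.2 hn1
  have hs0 : 0 < √(n : ℝ) := by linarith
  have hss : √(n : ℝ) * √(n : ℝ) = n := Real.mul_self_sqrt (by linarith)
  have hc : 0 < √n * √(relVariance ρ σ) := mul_pos hs0 (Real.sqrt_pos.2 hV)
  set c := √n * √(relVariance ρ σ) with hcdef
  have ht : 0 < 1 / √(n : ℝ) := by positivity
  have hβ : 0 < minTypeII ρ σ n ε := minTypeII_pos hρ hσ hsupp hε0 (by linarith)
  set β := minTypeII ρ σ n ε with hβdef
  -- the threshold balances the two error terms of the converse bound, with `t = 1 / √n`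
  set L := 1 / (8 * n * β) with hL
  have hL0 : 0 < L := by positivity
  set z := (Real.log L - n * relEntropy ρ σ) / c with hz
  have hlogL : Real.log L = n * relEntropy ρ σ + c * z := by
    rw [hz, mul_div_cancel₀ _ hc.ne']; ring
  have hconv := one_sub_le_of_log hρ hσ hsupp (n := n) hL0 ht hε0
  rw [hlogL] at hconv
  have hsmall : (1 + 1 / (1 / √(n : ℝ))) * (4 * L * β) ≤ 1 / √(n : ℝ) := by
    have e : (1 + 1 / (1 / √(n : ℝ))) * (4 * L * β) = (1 + √n) / (2 * n) := by
      rw [hL]; field_simp; ring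
    rw [e, div_le_div_iff₀ (by positivity) hs0]
    nlinarith
  have hΦ : normalCDF z ≤ ε + (δ + 1 / √n * 2) := by
    have := (abs_le.1 (hbe z)).1
    linarith
  have hq := le_normalQuantile hΦ
  have hlog : -Real.log β ≤ n * relEntropy ρ σ + c * z + Real.log (2 ^ 9 * (n : ℝ) ^ 2) := by
    have h1 : Real.log L = -(Real.log (8 * n) + Real.log β) := by
      rw [hL, one_div, Real.log_inv, Real.log_mul (by positivity) hβ.ne']
    have h2 : Real.log (8 * n) ≤ Real.log (2 ^ 9 * (n : ℝ) ^ 2) :=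
      Real.log_le_log (by positivity) (by nlinarith)
    linarith
  rw [negLog_of_pos hβ]
  refine (EReal.coe_le_coe_iff.2 hlog).trans ?_
  rw [EReal.coe_add, EReal.coe_add, EReal.coe_mul c]
  have hc' : (0 : EReal) ≤ (c : EReal) := by exact_mod_cast hc.le
  gcongr

end

end QHT

end

theorem theorem2 {ι : Type*} [Fintype ι] [DecidableEq ι] (ρ σ : Matrix ι ι ℂ)
    (hρ : QHT.IsDensityMatrix ρ) (hσ : QHT.IsDensityMatrix σ)
    (hsupp : QHT.supp ρ ≤ QHT.supp σ) (hV : 0 < QHT.relVariance ρ σ)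
    (ε : ℝ) (hε : ε ∈ Set.Icc (0 : ℝ) 1)
    (D V C T3 : ℝ) (hD : D = QHT.relEntropy ρ σ) (hVdef : V = QHT.relVariance ρ σ)
    (hC : C = QHT.berryEsseenConstant)
    (hT3 : T3 = QHT.absThirdMoment hρ.isHermitian hσ.isHermitian) :
    -- the lower bound
    (∀ n : ℕ, 1 ≤ n → 0 ≤ ε - 1 / √n * (C * T3 / √V ^ 3) →
      ((n * D : ℝ) : EReal)
          + ((√n * √V : ℝ) : EReal) * QHT.normalQuantile (ε - 1 / √n * (C * T3 / √V ^ 3))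
        ≤ QHT.negLog (QHT.minTypeII ρ σ n ε)) ∧
    -- the upper bound
    (∀ n : ℕ, 1 ≤ n → ε + 1 / √n * (C * T3 / √V ^ 3 + 2) ≤ 1 →
      QHT.negLog (QHT.minTypeII ρ σ n ε)
        ≤ ((n * D : ℝ) : EReal)
          + ((√n * √V : ℝ) : EReal) * QHT.normalQuantile (ε + 1 / √n * (C * T3 / √V ^ 3 + 2))
          + ((Real.log (2 ^ 9 * (n : ℝ) ^ 2) : ℝ) : EReal)) ∧
    -- the asymptotic expansions
    (0 < ε → ε < 1 →
      -- of the lower bound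
      (∃ r : ℕ → ℝ, r =O[atTop] (fun _ => (1 : ℝ)) ∧ ∀ᶠ n : ℕ in atTop,
        ((n * D : ℝ) : EReal)
            + ((√n * √V : ℝ) : EReal) * QHT.normalQuantile (ε - 1 / √n * (C * T3 / √V ^ 3))
          = ((n * D : ℝ) : EReal) + ((√n * √V : ℝ) : EReal) * QHT.normalQuantile ε
            + ((r n : ℝ) : EReal)) ∧
      -- of the upper bound
      (∃ r : ℕ → ℝ, r =O[atTop] (fun _ => (1 : ℝ)) ∧ ∀ᶠ n : ℕ in atTop,
        ((n * D : ℝ) : EReal)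
            + ((√n * √V : ℝ) : EReal) * QHT.normalQuantile (ε + 1 / √n * (C * T3 / √V ^ 3 + 2))
            + ((Real.log (2 ^ 9 * (n : ℝ) ^ 2) : ℝ) : EReal)
          = ((n * D : ℝ) : EReal) + ((√n * √V : ℝ) : EReal) * QHT.normalQuantile ε
            + ((2 * Real.log n + r n : ℝ) : EReal)) ∧
      -- of the minimal error exponent, with the range of its third-order term
      (∃ r : ℕ → ℝ, r =O[atTop] (fun n : ℕ => Real.log n) ∧
        (∃ K : ℝ, ∀ᶠ n : ℕ in atTop, -K ≤ r n ∧ r n ≤ 2 * Real.log n + K) ∧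
        ∀ n : ℕ, 1 ≤ n →
          QHT.negLog (QHT.minTypeII ρ σ n ε)
            = ((n * D : ℝ) : EReal) + ((√n * √V : ℝ) : EReal) * QHT.normalQuantile ε
              + ((r n : ℝ) : EReal))) := by
  subst hD hVdef hC hT3
  refine ⟨fun n hn _ => QHT.le_negLog_minTypeII hρ hσ hsupp hV hε hn,
    fun n hn h => QHT.negLog_minTypeII_le hρ hσ hsupp hV hε.1 hn h, fun hε0 hε1 => ?_⟩
  have hlower := fun {n : ℕ} (hn : 1 ≤ n) => QHT.le_negLog_minTypeII hρ hσ hsupp hV hε hn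
  have hupper := fun {n : ℕ} (hn : 1 ≤ n) => QHT.negLog_minTypeII_le hρ hσ hsupp hV hε.1 hn
  set D := QHT.relEntropy ρ σ
  set V := QHT.relVariance ρ σ
  set b := QHT.berryEsseenConstant * QHT.absThirdMoment hρ.isHermitian hσ.isHermitian / √V ^ 3
  have hb1 : ∀ n : ℕ, ε - 1 / √n * b = ε + -b / √n := fun n => by ring
  have hb2 : ∀ n : ℕ, ε + 1 / √n * (b + 2) = ε + (b + 2) / √n := fun n => by ring
  simp only [hb1, hb2] at hlower hupper ⊢
  obtain ⟨q, hq, s, ⟨K, hK⟩, hs⟩ := QHT.exists_normalQuantile_shift hε0 hε1 (-b)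
  obtain ⟨q', hq', s', ⟨K', hK'⟩, hs'⟩ := QHT.exists_normalQuantile_shift hε0 hε1 (b + 2)
  obtain rfl : q = q' := EReal.coe_injective (hq.symm.trans hq')
  rw [hq]
  have hlog : ∀ n : ℕ, 1 ≤ n →
      Real.log (2 ^ 9 * (n : ℝ) ^ 2) = Real.log (2 ^ 9) + 2 * Real.log n := fun n hn => by
    have : (n : ℝ) ≠ 0 := by positivity
    rw [Real.log_mul (by norm_num) (by positivity), Real.log_pow (n := 2)]
    norm_num
  have hbd : ∀ {n : ℕ} {u K : ℝ}, |√n * u| ≤ K → |√n * √V * u| ≤ √V * K := fun {n u K} h => by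
    rw [mul_right_comm, mul_comm, abs_mul, abs_of_nonneg (Real.sqrt_nonneg V)]
    exact mul_le_mul_of_nonneg_left h (Real.sqrt_nonneg V)
  refine ⟨⟨fun n => √n * √V * s n, ?_, ?_⟩, ⟨fun n => √n * √V * s' n + Real.log (2 ^ 9), ?_, ?_⟩,
    ⟨fun n => -Real.log (QHT.minTypeII ρ σ n ε) - n * D - √n * √V * q, ?_⟩⟩
  · refine IsBigO.of_bound (√V * K) ?_
    filter_upwards [hK] with n hn
    simpa using hbd hn
  · filter_upwards [hs] with n hn
    rw [hn]
    norm_cast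
    ring
  · refine IsBigO.of_bound (√V * K' + |Real.log (2 ^ 9)|) ?_
    filter_upwards [hK'] with n hn
    rw [norm_one, mul_one]
    exact (abs_add_le _ _).trans (add_le_add_left (hbd hn) _)
  · filter_upwards [hs', eventually_ge_atTop 1] with n hn hn1
    rw [hn, hlog n hn1]
    norm_cast
    ring
  have hrange : ∃ K : ℝ, ∀ᶠ n : ℕ in atTop,
      -K ≤ -Real.log (QHT.minTypeII ρ σ n ε) - n * D - √n * √V * q ∧
      -Real.log (QHT.minTypeII ρ σ n ε) - n * D - √n * √V * q ≤ 2 * Real.log n + K := by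
    have hle : ∀ᶠ n : ℕ in atTop, ε + (b + 2) / √n ≤ 1 := by
      have ht : Tendsto (fun n : ℕ => ε + (b + 2) / √(n : ℝ)) atTop (nhds (ε + 0)) :=
        ((Real.tendsto_sqrt_atTop.comp tendsto_natCast_atTop_atTop).const_div_atTop _).const_add _
      exact ht.eventually_le_const (by linarith)
    refine ⟨√V * K + √V * K' + |Real.log (2 ^ 9)|, ?_⟩
    filter_upwards [hs, hs', hK, hK', hle, eventually_ge_atTop 1] with n h1 h2 h3 h4 h5 hn
    have l := hlower hn
    have u := hupper hn h5
    have hβ := QHT.minTypeII_pos hρ hσ hsupp (n := n) hε0.le hε1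
    rw [h1, QHT.negLog_of_pos hβ] at l
    rw [h2, QHT.negLog_of_pos hβ, hlog n hn] at u
    norm_cast at l u
    have a1 := abs_le.1 (hbd h3)
    have a2 := abs_le.1 (hbd h4)
    have a3 := le_abs_self (Real.log (2 ^ 9))
    have a5 := (abs_nonneg _).trans (hbd h3)
    have a6 := (abs_nonneg _).trans (hbd h4)
    rw [mul_add] at l u
    norm_num at u a3 ⊢
    have a4 := abs_nonneg (Real.log 512)
    constructor <;> linarith
  refine ⟨?_, hrange, fun n hn => ?_⟩
  · obtain ⟨K, hK⟩ := hrange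
    refine IsBigO.of_bound (2 + |K|) ?_
    have hl : ∀ᶠ n : ℕ in atTop, 1 ≤ Real.log n :=
      (Real.tendsto_log_atTop.comp tendsto_natCast_atTop_atTop).eventually_ge_atTop 1
    filter_upwards [hK, hl] with n h1 h2
    have a1 := le_abs_self K
    have a2 := abs_nonneg K
    rw [Real.norm_eq_abs, Real.norm_eq_abs, abs_of_nonneg (by linarith : 0 ≤ Real.log n), abs_le]
    constructor <;> nlinarith
  · rw [QHT.negLog_of_pos (QHT.minTypeII_pos hρ hσ hsupp hε0.le hε1)]
    norm_cast
    ring
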